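/- **Setting.** There are $n$ bidders and $k\ge 1$ types of goods, each type with supply $s\in\mathbb N$; bidder $i$ has value $v_{ij}\in[0,1]$ for a good of type $j$. An assignment is a map $\mu:[n]\to[k]\cup\{\bot\}$; it is a matching if every type $j$ is assigned to at most $s$ bidders. Its weight (social welfare) is $\sum_{i:\mu(i)\ne\bot}v_{i\mu(i)}$, and $\mathrm{OPT}$ is the largest weight of a matching. Throughout, $\log$ is the logarithm to base 2. **Counter.** $\mathbf{Counter}(\varepsilon,N)$ reads a stream $\sigma(1),\sigma(2),\dots\in\{0,1\}$. At time $t$, let $i$ be the position of the lowest nonzero binary digit of $t$; set $a_i\leftarrow\sum_{j<i}a_j+\sigma(t)$, then $a_j,\hat a_j\leftarrow 0$ for $j<i$, and $\hat a_i\leftarrow a_i+Z_t$ with fresh Laplace noise $Z_t\sim\mathrm{Lap}(\log(N)/\varepsilon)$ (all $a_j,\hat a_j$ start at $0$). Let $B(t)=\sum\hat a_j$ over the positions $j$ of the nonzero binary digits of $t$. The reading at time $t$ is the monotone count $\max(0,B(1),\dots,B(t))$; the reading at time $0$ is $0$. Different counters use independent noise. **$\mathbf{PMatch}(\alpha,\rho,\varepsilon)$**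 (with confidence parameter $\gamma$). Put $T=\frac{8}{\alpha\rho}$, $\varepsilon'=\frac{\varepsilon}{2T}$, $E=\frac{2\sqrt2}{\varepsilon'}(\log nT)^{5/2}\log\frac{4k}{\gamma}$, $m=2E+1$. There are $k+1$ counters, counter$(0),\dots,$counter$(k)$, each a $\mathbf{Counter}(\varepsilon',nT)$. Initially $p_j=c_j=0$, $d_i=0$, $\mu(i)=\emptyset$. Perform at most $\lfloor T\rfloor$ rounds, each consisting of: 1. *Propose.* For $i=1,\dots,n$ in turn: if $\mu(i)=\emptyset$, choose $j\in\arg\max_{j}(v_{ij}-p_j)$, ties broken arbitrarily; if $v_{ij}-p_j\le 0$, set $\mu(i):=\bot$ and call Bid$(\mathbf 0)$; otherwise set $\mu(i):=j$, $d_i:=c_j$ and call Bid$(\mathbf e_j)$. If $\mu(i)\ne\emptyset$, call Bid$(\mathbf 0)$. Here Bid$(\mathbf b)$ does the following for every good $j$: feed $b_j$ to counter$(j)$, let $c_j$ be its new reading, and if $c_j\ge(p_j/\alpha+1)(s-m)$, set $p_j:=p_j+\alpha$. 2. *Count unsatisfied.* For $i=1,\dots,n$ in turn: if $\mu(i)\neq\bot$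 and $c_{\mu(i)}-d_i\ge s-m$, feed $1$ to counter$(0)$ and set $\mu(i):=\emptyset$; otherwise feed $0$ to counter$(0)$. If the reading of counter$(0)$ increased by less than $\rho n-2E$ during this round, halt. At the end every bidder with $\mu(i)=\emptyset$ gets $\mu(i):=\bot$; the output is $\mu$. **Theorem.** Let $0<\alpha\le1$, $\varepsilon>0$, $0<\gamma\le1$, and $$E'=\frac{288\sqrt2}{\alpha^2\varepsilon}\Bigl(\log\frac{72n}{\alpha^2}\Bigr)^{5/2}\log\frac{4k}{\gamma},$$ and assume $E'\ge1$ (which is automatic if $\varepsilon\le 10^4$). Let $\mu$ be the assignment computed by $\mathbf{PMatch}(\alpha/3,\alpha/3,\varepsilon)$. If $$s\ \ge\ \frac{16E'+4}{\alpha}\qquad\text{and}\qquad n>s,$$ then, for every tie-breaking rule, with probability at least $1-\gamma$ the assignment $\mu$ is a matching and has weight at least $\mathrm{OPT}-\alpha n$. Moreover $\frac{16E'+4}{\alpha}=O\bigl(\frac1{\alpha^3\varepsilon}\,\mathrm{polylog}(n,k,\frac1\alpha,\frac1\gamma)\bigr)$: there are absolute constants $C$ and $e$ such that, for all $n,k\ge1$,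 $0<\alpha\le1$, $\varepsilon>0$, $0<\gamma\le1$ with $E'\ge1$, $$\frac{16E'+4}{\alpha}\le\frac{C}{\alpha^3\varepsilon}\Bigl(1+\ln n+\ln k+\ln\tfrac1\alpha+\ln\tfrac1\gamma\Bigr)^{e}.$$ -/

import Mathlib

namespace PrivMatch

open MeasureTheory ProbabilityTheory

noncomputable section

/-! ### Laplace noise -/

/-- The standard Laplace distribution, with density `exp (-|x|) / 2`. -/
def stdLaplace : Measure ℝ :=
  volume.withDensity fun x => ENNReal.ofReal (Real.exp (-|x|) / 2)

theorem integral_stdLaplace_density : ∫ x : ℝ, Real.exp (-|x|) / 2 = 1 := by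
  rw [integral_div, integral_comp_abs (f := fun x => Real.exp (-x)), integral_exp_neg_Ioi_zero]
  norm_num

instance : IsProbabilityMeasure stdLaplace := by
  constructor
  have hint : Integrable (fun x : ℝ => Real.exp (-|x|) / 2) :=
    integrable_of_integral_eq_one integral_stdLaplace_density
  rw [stdLaplace, withDensity_apply _ MeasurableSet.univ, Measure.restrict_univ,
    ← ofReal_integral_eq_lintegral_ofReal hint (Filter.Eventually.of_forall fun x => by positivity),
    integral_stdLaplace_density, ENNReal.ofReal_one]

/-- `Lap(b)`: the law of `b * X` for `X` standard Laplace; its variance is `2 * b ^ 2`. -/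
def laplace (b : ℝ) : Measure ℝ := stdLaplace.map fun x => b * x

instance (b : ℝ) : IsProbabilityMeasure (laplace b) :=
  Measure.isProbabilityMeasure_map (by fun_prop)

/-! ### The streaming counter (binary mechanism) -/

/-- State of a streaming counter after `time` items: the partial sums `a i`, their noisy versions
`ahat i`, and the current reading `out`. -/
structure CounterState where
  time : ℕ
  a : ℕ → ℝ
  ahat : ℕ → ℝ
  out : ℝ

def CounterState.init : CounterState := ⟨0, fun _ => 0, fun _ => 0, 0⟩

/-- One step of the binary mechanism on the item `σ`. `z` is the noise stream of this counter: one
fresh noise value is used per time step, for the one partial sum that is completed at that step.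
At time `t`, `padicValNat 2 t` is the position of the lowest nonzero binary digit of `t`, and
`t.bitIndices` lists the positions of all its nonzero binary digits. The binary mechanism's estimate
is `B`; the counter's reading is made nondecreasing in time by keeping the largest estimate so far
(starting from the reading `0`). -/
def CounterState.feed (z : ℕ → ℝ) (σ : ℝ) (S : CounterState) : CounterState :=
  let t := S.time + 1
  let i := padicValNat 2 t
  let ai := ∑ j ∈ Finset.range i, S.a j + σ
  let a' : ℕ → ℝ := fun j => if j = i then ai else if j < i then 0 else S.a j
  let ahat' : ℕ → ℝ := fun j => if j = i then ai + z t else if j < i then 0 else S.ahat j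
  let B := (t.bitIndices.map ahat').sum
  ⟨t, a', ahat', max S.out B⟩

/-- Scale of the Laplace noise in `Counter(ε, T)`. -/
def counterScale (ε T : ℝ) : ℝ := Real.logb 2 T / ε

/-! ### The market -/

/-- An assignment of bidders to types of goods; `none` is the dummy good. -/
abbrev Assignment (n k : ℕ) := Fin n → Option (Fin k)

/-- No type of good is assigned to more bidders than its supply `s`. -/
def IsMatching {n k : ℕ} (s : ℕ) (μ : Assignment n k) : Prop :=
  ∀ j : Fin k, (Finset.univ.filter fun i => μ i = some j).card ≤ s

/-- Weight (social welfare) of an assignment; the dummy good has value `0`. -/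
def welfare {n k : ℕ} (v : Fin n → Fin k → ℝ) (μ : Assignment n k) : ℝ :=
  ∑ i, (μ i).elim 0 (v i)

/-- Weight of a maximum weight matching. -/
def OPT {n k : ℕ} (s : ℕ) (v : Fin n → Fin k → ℝ) : ℝ :=
  sSup (welfare v '' {μ | IsMatching s μ})

/-! ### The algorithm -/

/-- Market sizes (`n` bidders, `k` types of goods, supply `s` of each) and the parameters of the
algorithm. -/
structure Params where
  n : ℕ
  k : ℕ
  s : ℕ
  α : ℝ
  ρ : ℝ
  ε : ℝ
  γ : ℝ

namespace Params

variable (P : Params)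

def T : ℝ := 8 / (P.α * P.ρ)

def ε' : ℝ := P.ε / (2 * P.T)

def E : ℝ :=
  2 * Real.sqrt 2 / P.ε' * Real.logb 2 (P.n * P.T) ^ (5 / 2 : ℝ) * Real.logb 2 (4 * P.k / P.γ)

/-- The reserved supply. -/
def m : ℝ := 2 * P.E + 1

end Params

/-- What a bidder currently holds: nothing yet (`empty`, written `∅`), the dummy good
(`bot`, written `⊥`), or a type of good. -/
inductive Slot (k : ℕ) where
  | empty
  | bot
  | good (j : Fin k)

/-- Noise streams of all counters: `some j` is the counter of good `j`, `none` is counter(0). -/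
abbrev Noise (k : ℕ) := Option (Fin k) × ℕ → ℝ

structure State (n k : ℕ) where
  ctr : Option (Fin k) → CounterState
  p : Fin k → ℝ
  c : Fin k → ℝ
  d : Fin n → ℝ
  μ : Fin n → Slot k

def State.init (n k : ℕ) : State n k :=
  ⟨fun _ => CounterState.init, fun _ => 0, fun _ => 0, fun _ => 0, fun _ => Slot.empty⟩

section Algorithm

variable (P : Params) (v : Fin P.n → Fin P.k → ℝ)
  (tie : ℕ → Fin P.n → (Fin P.k → ℝ) → Fin P.k) (ω : Noise P.k)

/-- **Bid** on input the bid vector `b`. -/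
def bid (b : Fin P.k → ℝ) (S : State P.n P.k) : State P.n P.k :=
  let ctr' : Option (Fin P.k) → CounterState := fun q =>
    q.elim (S.ctr none) fun j => (S.ctr (some j)).feed (fun t => ω (some j, t)) (b j)
  let c' : Fin P.k → ℝ := fun j => (ctr' (some j)).out
  { S with
    ctr := ctr'
    c := c'
    p := fun j =>
      if (S.p j / P.α + 1) * (P.s - P.m) ≤ c' j then S.p j + P.α else S.p j }

open Classical in
/-- The turn of bidder `i` in **Propose**, in round `r`. The rule `tie` picks the utility-maximizing
good. -/
def proposeStep (r : ℕ) (S : State P.n P.k) (i : Fin P.n) : State P.n P.k :=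
  match S.μ i with
  | Slot.empty =>
    let j := tie r i fun j => v i j - S.p j
    if v i j - S.p j ≤ 0 then
      bid P ω (fun _ => 0) { S with μ := Function.update S.μ i Slot.bot }
    else
      bid P ω (Pi.single j 1)
        { S with μ := Function.update S.μ i (Slot.good j), d := Function.update S.d i (S.c j) }
  | _ => bid P ω (fun _ => 0) S

/-- Feed one item to counter(0). -/
def feedZero (σ : ℝ) (S : State P.n P.k) : State P.n P.k :=
  { S with ctr := Function.update S.ctr none ((S.ctr none).feed (fun t => ω (none, t)) σ) }

open Classical in
/-- The turn of bidder `i` in **CountUnsatisfied**. -/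
def countStep (S : State P.n P.k) (i : Fin P.n) : State P.n P.k :=
  match S.μ i with
  | Slot.good j =>
    if (P.s : ℝ) - P.m ≤ S.c j - S.d i then
      feedZero P ω 1 { S with μ := Function.update S.μ i Slot.empty }
    else feedZero P ω 0 S
  | _ => feedZero P ω 0 S

/-- One full round: every bidder proposes in turn, then every bidder is checked in turn. -/
def fullRound (r : ℕ) (S : State P.n P.k) : State P.n P.k :=
  (List.finRange P.n).foldl (countStep P ω)
    ((List.finRange P.n).foldl (proposeStep P v tie ω r) S)

open Classical in
/-- At most `fuel` further rounds, the first of them having number `r`; stop as soon as counter(0)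
increases by less than `ρ n - 2 E` within a round. -/
def run : (fuel r : ℕ) → State P.n P.k → State P.n P.k
  | 0, _, S => S
  | fuel + 1, r, S =>
    let S' := fullRound P v tie ω r S
    if (S'.ctr none).out - (S.ctr none).out < P.ρ * P.n - 2 * P.E then S'
    else run fuel (r + 1) S'

/-- The final assignment: a bidder who holds nothing at the end is matched to the dummy good. -/
def State.assignment {n k : ℕ} (S : State n k) : Assignment n k := fun i =>
  match S.μ i with
  | Slot.good j => some j
  | _ => none

/-- The assignment computed by `PMatch(α, ρ, ε)` for the noise outcome `ω`; the number of rounds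
is the integer part of `T`. -/
def pmatch : Assignment P.n P.k :=
  (run P v tie ω ⌊P.T⌋₊ 0 (State.init P.n P.k)).assignment

/-- The joint law of the noise of all the counters, each of which is `Counter(ε', nT)`:
independent `Lap(log(nT) / ε')` variables. -/
def noiseLaw : Measure (Noise P.k) :=
  Measure.infinitePi fun _ => laplace (counterScale P.ε' (P.n * P.T))

end Algorithm

/-- A tie-breaking rule: in round `r`, given the vector `u` of the utilities of bidder `i` for the
goods, it picks a good of maximal utility. -/
def IsTieRule {n k : ℕ} (tie : ℕ → Fin n → (Fin k → ℝ) → Fin k) : Prop :=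
  ∀ (r : ℕ) (i : Fin n) (u : Fin k → ℝ) (j : Fin k), u j ≤ u (tie r i u)

/-- The quantity `E'` of the supply condition. -/
def Eprime (n k : ℕ) (α ε γ : ℝ) : ℝ :=
  288 * Real.sqrt 2 / (α ^ 2 * ε) * Real.logb 2 (72 * n / α ^ 2) ^ (5 / 2 : ℝ) *
    Real.logb 2 (4 * k / γ)

end

end PrivMatch

namespace PrivMatch

open MeasureTheory ProbabilityTheory

noncomputable section

/-! ### Binary digits of consecutive numbers -/

/-! The proof separates chance from dynamics through the event `GoodNoise`: every counter stays
within `E` of its true count at all times. The streams are adaptive, but the error of the binary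
mechanism is `noiseSum`, which depends on the noise alone. It is a sum of logarithmically many
independent Laplace variables, so a Chernoff bound and a union bound over counters and times give
the event probability at least `1 - γ` (`measure_not_goodNoise_le`, `failure_bound`).

On good noise the auction is controlled by the invariant `Inv`. One bid moves a reading by at most
`m < cap`, where `cap = s - m`, so prices climb one level at a time, about once per `cap` bids. A
bidder is released once the reading has grown by `cap` since his bid. Hence after a full round a
good has fewer than `cap + 2E` holders, which is below `s`, and a good with positive price has at
least `s - 4E - 2` of them (`Inv.card_holders_lt`, `Inv.le_card_holders`). The price has risen by at
most one step since a satisfied bidder's bid, so his choice is optimal up to `α`.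

Summing utilities against any matching, prices cancel up to `4E + 2` per priced good. There are at
most `n / (s - 4E - 2)` priced goods, so this loss, the step `α` per bidder and the few unsatisfied
bidders together cost at most `3αn` (`Inv.welfare_le`, `loss_le`).

The algorithm halts in time: a good is bid on only while its price is below 1, so it receives about
`cap / α` bids, and the releases total `O(n / α)`. A round that does not halt raises the reading of
counter(0) by order `αn`, which is impossible for all `⌊T⌋` rounds (`Inv.run`, `rounds_bound`). -/

theorem exists_eq_two_pow_mul_odd (t : ℕ) :
    ∃ q, t + 1 = 2 ^ padicValNat 2 (t + 1) * (2 * q + 1) := by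
  obtain ⟨c, hc⟩ := pow_padicValNat_dvd (p := 2) (n := t + 1)
  have hodd : ¬ 2 ∣ c := fun ⟨d, hd⟩ =>
    pow_succ_padicValNat_not_dvd (p := 2) (n := t + 1) (Nat.succ_ne_zero t)
      ⟨d, by rw [pow_succ, mul_assoc, ← hd]; exact hc⟩
  exact ⟨c / 2, by rw [show 2 * (c / 2) + 1 = c by omega]; exact hc⟩

/-- Adding one is a carry: `t` ends in a 0 followed by `i` ones, `t + 1` in a 1 followed by `i`
zeros. The digit lemmas below are read off from these two forms. -/
theorem exists_pred_eq_two_pow_mul_add (t : ℕ) :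
    ∃ q, t + 1 = 2 ^ padicValNat 2 (t + 1) * (2 * q + 1) ∧
      t = 2 ^ padicValNat 2 (t + 1) * (2 * q) + (2 ^ padicValNat 2 (t + 1) - 1) := by
  obtain ⟨q, hq⟩ := exists_eq_two_pow_mul_odd t
  refine ⟨q, hq, ?_⟩
  have h1 : 0 < 2 ^ padicValNat 2 (t + 1) := by positivity
  rw [mul_add, mul_one] at hq
  omega

theorem testBit_of_lt_padicValNat_succ {t j : ℕ} (h : j < padicValNat 2 (t + 1)) :
    t.testBit j = true := by
  obtain ⟨q, -, ht⟩ := exists_pred_eq_two_pow_mul_add t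
  rw [ht, Nat.testBit_two_pow_mul_add _ (Nat.sub_lt (by positivity) one_pos), if_pos h]
  simp [h]

theorem testBit_padicValNat_succ (t : ℕ) : t.testBit (padicValNat 2 (t + 1)) = false := by
  obtain ⟨q, -, ht⟩ := exists_pred_eq_two_pow_mul_add t
  rw [congrArg Nat.testBit ht, Nat.testBit_two_pow_mul_add _ (Nat.sub_lt (by positivity) one_pos)]
  simp

theorem succ_testBit_of_lt {t j : ℕ} (h : j < padicValNat 2 (t + 1)) :
    (t + 1).testBit j = false := by
  obtain ⟨q, ht, -⟩ := exists_pred_eq_two_pow_mul_add t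
  rw [congrArg Nat.testBit ht, Nat.testBit_two_pow_mul]
  simp [h]

theorem succ_testBit_self (t : ℕ) : (t + 1).testBit (padicValNat 2 (t + 1)) = true := by
  obtain ⟨q, ht, -⟩ := exists_pred_eq_two_pow_mul_add t
  rw [congrArg Nat.testBit ht, Nat.testBit_two_pow_mul]
  simp

theorem succ_div_two_pow_of_lt {t j : ℕ} (h : padicValNat 2 (t + 1) < j) :
    (t + 1) / 2 ^ j = t / 2 ^ j := by
  obtain ⟨q, ht, ht'⟩ := exists_pred_eq_two_pow_mul_add t
  generalize padicValNat 2 (t + 1) = i at *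
  obtain ⟨e, rfl⟩ := Nat.exists_eq_add_of_lt h
  have h1 : 0 < 2 ^ i := by positivity
  have hlt : 2 ^ i - 1 < 2 ^ i := Nat.sub_lt h1 one_pos
  rw [show 2 ^ (i + e + 1) = 2 ^ i * 2 * 2 ^ e by ring, ← Nat.div_div_eq_div_mul,
    ← Nat.div_div_eq_div_mul, ← Nat.div_div_eq_div_mul, ← Nat.div_div_eq_div_mul]
  congr 1
  rw [ht, Nat.mul_div_cancel_left _ h1, ht', Nat.mul_add_div h1, Nat.div_eq_of_lt hlt]
  omega

theorem succ_testBit_of_gt {t j : ℕ} (h : padicValNat 2 (t + 1) < j) :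
    (t + 1).testBit j = t.testBit j := by
  simp [Nat.testBit_eq_decide_div_mod_eq, succ_div_two_pow_of_lt h]

theorem succ_div_mul_two_pow_self (t : ℕ) :
    (t + 1) / 2 ^ padicValNat 2 (t + 1) * 2 ^ padicValNat 2 (t + 1) = t + 1 :=
  Nat.div_mul_cancel pow_padicValNat_dvd

/-- The positions of the nonzero binary digits. -/
def bits (t : ℕ) : Finset ℕ := t.bitIndices.toFinset

theorem mem_bits {t j : ℕ} : j ∈ bits t ↔ t.testBit j = true := by simp [bits]

theorem bits_succ (t : ℕ) :
    bits (t + 1) = insert (padicValNat 2 (t + 1))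
      (bits t \ Finset.range (padicValNat 2 (t + 1))) := by
  ext j
  rw [Finset.mem_insert, Finset.mem_sdiff, Finset.mem_range, mem_bits, mem_bits]
  rcases lt_trichotomy j (padicValNat 2 (t + 1)) with h | h | h
  · simp [succ_testBit_of_lt h, h, h.ne]
  · subst h; simp [succ_testBit_self]
  · simp [succ_testBit_of_gt h, h.le, h.ne']

theorem range_subset_bits (t : ℕ) : Finset.range (padicValNat 2 (t + 1)) ⊆ bits t := fun _ hj =>
  mem_bits.2 (testBit_of_lt_padicValNat_succ (Finset.mem_range.1 hj))

theorem card_bits_le (t : ℕ) : (bits t).card ≤ Nat.log 2 t + 1 := by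
  calc (bits t).card ≤ (Finset.range (Nat.log 2 t + 1)).card := by
        refine Finset.card_le_card fun j hj => ?_
        have := Nat.two_pow_le_of_mem_bitIndices (List.mem_toFinset.1 hj)
        exact Finset.mem_range.2 (Nat.lt_succ_of_le (Nat.le_log_of_pow_le (by norm_num) this))
    _ = _ := Finset.card_range _

/-- The time at which the partial sum in position `j`, in use at time `t`, was completed. -/
def blockEnd (t j : ℕ) : ℕ := t / 2 ^ j * 2 ^ j

/-- This makes the terms of `noiseSum` distinct, hence independent, noise coordinates. For `i < j`,
digit `i` survives in `blockEnd t i` but is cleared in `blockEnd t j`. -/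
theorem blockEnd_injOn (t : ℕ) : Set.InjOn (blockEnd t) (bits t) := by
  have key : ∀ i j, t.testBit i = true → i < j → blockEnd t i ≠ blockEnd t j := by
    intro i j hi hij h
    have h1 := congrArg (fun x => Nat.testBit x i) h
    simp only [blockEnd, Nat.testBit_mul_two_pow] at h1
    rw [Nat.sub_self, Nat.testBit_div_two_pow, zero_add, hi] at h1
    simp [hij.not_ge] at h1
  intro i hi j hj h
  rcases lt_trichotomy i j with hij | hij | hij
  · exact absurd h (key i j (mem_bits.1 hi) hij)
  · exact hij
  · exact absurd h.symm (key j i (mem_bits.1 hj) hij)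

/-- The error of the binary mechanism at time `t`. -/
def noiseSum (z : ℕ → ℝ) (t : ℕ) : ℝ := ∑ j ∈ bits t, z (blockEnd t j)

/-! ### Accuracy of the counter -/

/-- The counter state `S` is the result of a stream with total `C`. -/
structure CounterState.Tracks (z : ℕ → ℝ) (S : CounterState) (C : ℝ) : Prop where
  ahat_eq : ∀ j ∈ bits S.time, S.ahat j = S.a j + z (blockEnd S.time j)
  sum_a : ∑ j ∈ bits S.time, S.a j = C

theorem CounterState.tracks_init (z : ℕ → ℝ) : CounterState.init.Tracks z 0 := by
  constructor <;> simp [CounterState.init, bits]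

/-- The new block absorbs exactly the blocks below the carry position, all in use by
`range_subset_bits`. Blocks above it keep their value and completion time. -/
theorem CounterState.Tracks.feed {z : ℕ → ℝ} {S : CounterState} {C : ℝ} (h : S.Tracks z C)
    (σ : ℝ) : (S.feed z σ).Tracks z (C + σ) := by
  have hnot : padicValNat 2 (S.time + 1) ∉
      bits S.time \ Finset.range (padicValNat 2 (S.time + 1)) := by
    simp [mem_bits, testBit_padicValNat_succ]
  constructor
  · intro j hj
    simp only [CounterState.feed] at hj ⊢
    rw [bits_succ, Finset.mem_insert, Finset.mem_sdiff, Finset.mem_range, not_lt] at hj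
    by_cases hji : j = padicValNat 2 (S.time + 1)
    · subst hji
      simp [blockEnd, succ_div_mul_two_pow_self]
    · obtain ⟨hb, hle⟩ := hj.resolve_left hji
      have hlt : padicValNat 2 (S.time + 1) < j := lt_of_le_of_ne hle (Ne.symm hji)
      simp only [hji, hle.not_gt, if_false]
      rw [h.ahat_eq j hb, blockEnd, blockEnd, succ_div_two_pow_of_lt hlt]
  · simp only [CounterState.feed]
    rw [bits_succ, Finset.sum_insert hnot, if_pos rfl, ← h.sum_a,
      ← Finset.sum_sdiff (range_subset_bits S.time)]
    have : ∀ j ∈ bits S.time \ Finset.range (padicValNat 2 (S.time + 1)),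
        (if j = padicValNat 2 (S.time + 1) then
          ∑ j ∈ Finset.range (padicValNat 2 (S.time + 1)), S.a j + σ
          else if j < padicValNat 2 (S.time + 1) then 0 else S.a j) = S.a j := by
      intro j hj
      have h1 : j ≠ padicValNat 2 (S.time + 1) := fun h => hnot (h ▸ hj)
      have h2 : ¬ j < padicValNat 2 (S.time + 1) := by simpa using (Finset.mem_sdiff.1 hj).2
      rw [if_neg h1, if_neg h2]
    rw [Finset.sum_congr rfl this]
    ring

theorem CounterState.Tracks.sum_ahat {z : ℕ → ℝ} {S : CounterState} {C : ℝ} (h : S.Tracks z C) :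
    (S.time.bitIndices.map S.ahat).sum = C + noiseSum z S.time := by
  rw [← List.sum_toFinset _ Nat.bitIndices_nodup, noiseSum, ← h.sum_a, ← Finset.sum_add_distrib]
  exact Finset.sum_congr rfl h.ahat_eq

/-- The counter state `S` is the result of a stream with total `C`, and its reading is within `E`
of `C`. -/
structure CounterState.Accurate (z : ℕ → ℝ) (E : ℝ) (S : CounterState) (C : ℝ) : Prop where
  tracks : S.Tracks z C
  le_out : C - E ≤ S.out
  out_le : S.out ≤ C + E

theorem CounterState.accurate_init (z : ℕ → ℝ) {E : ℝ} (hE : 0 ≤ E) :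
    CounterState.init.Accurate z E 0 :=
  ⟨CounterState.tracks_init z, by simpa [CounterState.init], by simpa [CounterState.init]⟩

theorem CounterState.out_le_feed (z : ℕ → ℝ) (σ : ℝ) (S : CounterState) :
    S.out ≤ (S.feed z σ).out := le_max_left _ _

/-- Taking the running maximum does no harm: the newest estimate gives the lower bound, and the old
upper bound persists because `0 ≤ σ` keeps the total from decreasing. -/
theorem CounterState.Accurate.feed {z : ℕ → ℝ} {E : ℝ} {S : CounterState} {C : ℝ}
    (h : S.Accurate z E C) {σ : ℝ} (hσ : 0 ≤ σ) (hz : |noiseSum z (S.time + 1)| ≤ E) :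
    (S.feed z σ).Accurate z E (C + σ) := by
  have ht := h.tracks.feed σ
  have hout : (S.feed z σ).out = max S.out (C + σ + noiseSum z (S.time + 1)) :=
    congrArg (max S.out) ht.sum_ahat
  have hz' := abs_le.1 hz
  refine ⟨ht, ?_, ?_⟩
  · rw [hout]; exact le_trans (by linarith) (le_max_right _ _)
  · rw [hout]; exact max_le (by linarith [h.out_le]) (by linarith)

/-! ### Concentration of the noise -/

theorem integral_exp_neg_half_abs : ∫ x : ℝ, Real.exp (-(|x| / 2)) / 2 = 2 := by
  rw [integral_div, integral_comp_abs (f := fun x => Real.exp (-(x / 2)))]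
  have h : ∫ x in Set.Ioi (0 : ℝ), Real.exp (-(x / 2)) = 2 := by
    have := integral_exp_mul_Ioi (a := -(1 / 2 : ℝ)) (by norm_num) 0
    simp only [mul_zero, Real.exp_zero] at this
    rw [show (fun x : ℝ => Real.exp (-(x / 2))) = fun x => Real.exp (-(1 / 2) * x) by
      ext x; congr 1; ring, this]
    norm_num
  rw [h]; norm_num

theorem integrable_exp_half_abs_stdLaplace :
    Integrable (fun x : ℝ => Real.exp (|x| / 2)) stdLaplace := by
  rw [stdLaplace, integrable_withDensity_iff_integrable_smul' (by fun_prop)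
    (Filter.Eventually.of_forall fun x => ENNReal.ofReal_lt_top)]
  -- A function that is not integrable has integral 0 by convention, so the value 2 already proves
  -- integrability.
  refine Integrable.congr (f := fun x : ℝ => Real.exp (-(|x| / 2)) / 2)
    (not_imp_comm.1 integral_undef (by rw [integral_exp_neg_half_abs]; norm_num)) ?_
  refine Filter.Eventually.of_forall fun x => ?_
  simp only [smul_eq_mul]
  rw [ENNReal.toReal_ofReal (by positivity), div_mul_eq_mul_div, ← Real.exp_add]
  congr 2; ring

theorem integral_exp_half_abs_stdLaplace :
    ∫ x, Real.exp (|x| / 2) ∂stdLaplace = 2 := by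
  rw [stdLaplace, integral_withDensity_eq_integral_toReal_smul (by fun_prop)
    (Filter.Eventually.of_forall fun x => ENNReal.ofReal_lt_top)]
  refine (integral_congr_ae (Filter.Eventually.of_forall fun x => ?_)).trans
    integral_exp_neg_half_abs
  simp only [smul_eq_mul]
  rw [ENNReal.toReal_ofReal (by positivity), div_mul_eq_mul_div, ← Real.exp_add]
  congr 2; ring

theorem exp_abs_const_mul {b : ℝ} (hb : 0 < b) (x : ℝ) :
    Real.exp (1 / (2 * b) * |b * x|) = Real.exp (|x| / 2) := by
  rw [abs_mul, abs_of_pos hb]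
  congr 1; field_simp

theorem integrable_exp_abs_laplace {b : ℝ} (hb : 0 < b) :
    Integrable (fun x : ℝ => Real.exp (1 / (2 * b) * |x|)) (laplace b) := by
  rw [laplace, integrable_map_measure (by fun_prop) (by fun_prop)]
  refine integrable_exp_half_abs_stdLaplace.congr (Filter.Eventually.of_forall fun x => ?_)
  exact (exp_abs_const_mul hb x).symm

theorem mgf_abs_laplace {b : ℝ} (hb : 0 < b) :
    mgf (fun x => |x|) (laplace b) (1 / (2 * b)) = 2 := by
  rw [mgf, laplace, integral_map (by fun_prop) (by fun_prop)]
  exact (integral_congr_ae (Filter.Eventually.of_forall fun x => exp_abs_const_mul hb x)).trans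
    integral_exp_half_abs_stdLaplace

/-- Chernoff bound for a sum of absolute values of independent Laplace variables. -/
theorem measure_sum_abs_ge_le {ι : Type*} {b : ℝ} (hb : 0 < b) (s : Finset ι) (x : ℝ) :
    (Measure.infinitePi fun _ : ι => laplace b).real {ω | x ≤ ∑ i ∈ s, |ω i|} ≤
      Real.exp (-(1 / (2 * b)) * x) * 2 ^ s.card := by
  set ν := Measure.infinitePi fun _ : ι => laplace b
  have hind : iIndepFun (fun (i : ι) (ω : ι → ℝ) => |ω i|) ν :=
    iIndepFun_infinitePi (X := fun _ x => |x|) (fun _ => by fun_prop)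
  have hint : ∀ i, Integrable (fun ω : ι → ℝ => Real.exp (1 / (2 * b) * |ω i|)) ν := fun i =>
    (measurePreserving_eval_infinitePi (fun _ : ι => laplace b) i).integrable_comp_of_integrable
      (integrable_exp_abs_laplace hb)
  have hmgf : ∀ i, mgf (fun ω : ι → ℝ => |ω i|) ν (1 / (2 * b)) = 2 := fun i => by
    have hmap := measurePreserving_eval_infinitePi (fun _ : ι => laplace b) i
    have h := mgf_abs_laplace hb
    rwa [← hmap.map_eq, mgf_map hmap.measurable.aemeasurable (by fun_prop)] at h
  have h := measure_ge_le_exp_mul_mgf (μ := ν) x (by positivity : 0 ≤ 1 / (2 * b))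
    (hind.integrable_exp_mul_sum (fun i => by fun_prop) (s := s) fun i _ => hint i)
  rw [hind.mgf_sum (fun i => by fun_prop), Finset.prod_congr rfl fun i _ => hmgf i,
    Finset.prod_const] at h
  simpa [Finset.sum_apply] using h

theorem measure_noiseSum_gt_le {κ : Type*} {b : ℝ} (hb : 0 < b) (q : κ) (t : ℕ) (x : ℝ) :
    (Measure.infinitePi fun _ : κ × ℕ => laplace b).real
      {ω | x < |noiseSum (fun u => ω (q, u)) t|} ≤
      Real.exp (-(1 / (2 * b)) * x) * 2 ^ (bits t).card := by
  classical
  have hinj : Set.InjOn (fun j => (q, blockEnd t j)) (bits t) := fun i hi j hj h =>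
    blockEnd_injOn t hi hj (Prod.ext_iff.1 h).2
  rw [← Finset.card_image_of_injOn hinj]
  refine le_trans ?_ (measure_sum_abs_ge_le hb ((bits t).image fun j => (q, blockEnd t j)) x)
  refine measureReal_mono (fun ω hω => ?_) (measure_ne_top _ _)
  simp only [Set.mem_ofPred_eq] at hω ⊢
  rw [Finset.sum_image hinj]
  exact hω.le.trans (Finset.abs_sum_le_sum_abs _ _)

/-- The noise outcomes for which all counters have error at most `E` up to time `N`. -/
def GoodNoise (k : ℕ) (E : ℝ) (N : ℕ) (ω : Noise k) : Prop :=
  ∀ q, ∀ t ∈ Finset.Icc 1 N, |noiseSum (fun u => ω (q, u)) t| ≤ E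

theorem measure_not_goodNoise_le {k : ℕ} {b E : ℝ} (hb : 0 < b) (N : ℕ) :
    (Measure.infinitePi fun _ : Option (Fin k) × ℕ => laplace b).real
      {ω | ¬ GoodNoise k E N ω} ≤
      (k + 1) * N * (Real.exp (-(1 / (2 * b)) * E) * (2 * N)) := by
  have hsub : {ω | ¬ GoodNoise k E N ω} ⊆ ⋃ q ∈ (Finset.univ : Finset (Option (Fin k))),
      ⋃ t ∈ Finset.Icc 1 N, {ω : Noise k | E < |noiseSum (fun u => ω (q, u)) t|} := by
    intro ω hω
    simp only [GoodNoise, Set.mem_ofPred_eq, not_forall, not_le] at hω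
    obtain ⟨q, t, ht, h⟩ := hω
    simp only [Set.mem_iUnion]
    exact ⟨q, Finset.mem_univ q, t, ht, h⟩
  have hone : ∀ q : Option (Fin k), ∀ t ∈ Finset.Icc 1 N,
      (Measure.infinitePi fun _ : Option (Fin k) × ℕ => laplace b).real
        {ω | E < |noiseSum (fun u => ω (q, u)) t|} ≤
        Real.exp (-(1 / (2 * b)) * E) * (2 * N) := by
    intro q t ht
    refine (measure_noiseSum_gt_le hb q t E).trans ?_
    gcongr
    obtain ⟨h1, h2⟩ := Finset.mem_Icc.1 ht
    -- Each noise term contributes a factor 2 to the moment generating function; there are only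
    -- logarithmically many.
    have h3 : 2 ^ (bits t).card ≤ 2 * N :=
      calc 2 ^ (bits t).card ≤ 2 ^ (Nat.log 2 t + 1) :=
            Nat.pow_le_pow_right (by norm_num) (card_bits_le t)
        _ = 2 * 2 ^ Nat.log 2 t := by ring
        _ ≤ 2 * N := Nat.mul_le_mul_left _ ((Nat.pow_log_le_self 2 (by omega)).trans h2)
    exact_mod_cast h3
  calc _ ≤ _ := measureReal_mono hsub (measure_ne_top _ _)
    _ ≤ ∑ q : Option (Fin k), _ := measureReal_biUnion_finset_le _ _
    _ ≤ ∑ q : Option (Fin k), ∑ t ∈ Finset.Icc 1 N, Real.exp (-(1 / (2 * b)) * E) * (2 * N) :=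
        Finset.sum_le_sum fun q _ => (measureReal_biUnion_finset_le _ _).trans
          (Finset.sum_le_sum (hone q))
    _ = _ := by simp; ring

/-- `A` need not be measurable: subadditivity in the form `1 ≤ ν A + ν Aᶜ` suffices. -/
theorem le_measure_of_goodNoise {k : ℕ} {b E γ : ℝ} {N : ℕ} {A : Set (Noise k)} (hb : 0 < b)
    (hγ : (k + 1) * N * (Real.exp (-(1 / (2 * b)) * E) * (2 * N)) ≤ γ)
    (hA : ∀ ω, GoodNoise k E N ω → ω ∈ A) :
    ENNReal.ofReal (1 - γ) ≤ (Measure.infinitePi fun _ : Option (Fin k) × ℕ => laplace b) A := by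
  set ν := Measure.infinitePi fun _ : Option (Fin k) × ℕ => laplace b
  have h1 : ν.real Aᶜ ≤ γ := by
    refine le_trans (measureReal_mono (fun ω hω => ?_) (measure_ne_top _ _))
      ((measure_not_goodNoise_le hb N).trans hγ)
    exact fun h => hω (hA ω h)
  have h2 : 1 ≤ ν.real A + ν.real Aᶜ := by
    have := measureReal_union_le (μ := ν) A Aᶜ
    rwa [Set.union_compl_self, probReal_univ] at this
  refine ENNReal.ofReal_le_of_le_toReal ?_
  change 1 - γ ≤ ν.real A
  linarith

/-! ### Numerical estimates -/

theorem rpow_five_half {L : ℝ} (hL : 0 < L) : L ^ (5 / 2 : ℝ) = L ^ 2 * Real.sqrt L := by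
  rw [show (5 / 2 : ℝ) = (2 : ℕ) + 1 / 2 by norm_num, Real.rpow_add hL, Real.rpow_natCast,
    Real.sqrt_eq_rpow]

theorem log_le_logb_two {x : ℝ} (hx : 1 ≤ x) : Real.log x ≤ Real.logb 2 x := by
  rw [Real.logb, le_div_iff₀ (Real.log_pos (by norm_num))]
  exact mul_le_of_le_one_right (Real.log_nonneg hx) (Real.log_two_lt_d9.le.trans (by norm_num))

theorem logb_two_le_two_mul_log {x : ℝ} (hx : 1 ≤ x) : Real.logb 2 x ≤ 2 * Real.log x := by
  rw [Real.logb, div_le_iff₀ (Real.log_pos (by norm_num))]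
  nlinarith [Real.log_nonneg hx, Real.log_two_gt_d9]

theorem two_le_logb_four_mul_div {k : ℕ} {γ : ℝ} (hk : 1 ≤ k) (hγ : 0 < γ) (hγ1 : γ ≤ 1) :
    2 ≤ Real.logb 2 (4 * k / γ) := by
  have hk' : (1 : ℝ) ≤ k := by exact_mod_cast hk
  rw [Real.le_logb_iff_rpow_le (by norm_num) (by positivity), le_div_iff₀ hγ]
  norm_num
  nlinarith

/-- The failure probability of the counters, with the noise scale and the error bound of the
algorithm. -/
theorem failure_bound {k N : ℕ} {M ε' γ : ℝ} (hk : 1 ≤ k) (hγ : 0 < γ) (hγ1 : γ ≤ 1)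
    (hε : 0 < ε') (hM : 32 ≤ M) (hN : (N : ℝ) ≤ M) :
    (k + 1) * N * (Real.exp (-(1 / (2 * counterScale ε' M)) * (2 * Real.sqrt 2 / ε' *
      Real.logb 2 M ^ (5 / 2 : ℝ) * Real.logb 2 (4 * k / γ))) * (2 * N)) ≤ γ := by
  have hk' : (1 : ℝ) ≤ k := by exact_mod_cast hk
  have hB2 := two_le_logb_four_mul_div hk hγ hγ1
  have hL5 : 5 ≤ Real.logb 2 M := by
    rw [Real.le_logb_iff_rpow_le (by norm_num) (by linarith)]
    norm_num; exact hM
  have hx := log_le_logb_two (x := M) (by linarith)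
  have hy := log_le_logb_two (x := 4 * k / γ) (by rw [le_div_iff₀ hγ]; nlinarith)
  rw [counterScale]
  set L := Real.logb 2 M
  set B := Real.logb 2 (4 * k / γ)
  have hL0 : 0 < L := by linarith
  have hs : 3 ≤ Real.sqrt 2 * Real.sqrt L := by
    rw [← Real.sqrt_mul (by norm_num)]
    exact Real.le_sqrt_of_sq_le (by linarith)
  have hexp : -(1 / (2 * (L / ε'))) * (2 * Real.sqrt 2 / ε' * L ^ (5 / 2 : ℝ) * B) =
      -(Real.sqrt 2 * Real.sqrt L * (L * B)) := by
    rw [rpow_five_half hL0]; field_simp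
  -- Since `√(2L) ≥ 3`, the exponent is at least `3LB`. The part `2L` pays for the factor `M ^ 2` of
  -- the union bound, the part `B` for `4k / γ`.
  have hLB : 2 * L + B ≤ Real.sqrt 2 * Real.sqrt L * (L * B) := by
    have h1 : 0 ≤ L * B := by positivity
    nlinarith [mul_le_mul_of_nonneg_right hs h1]
  have hbound : Real.exp (-(Real.sqrt 2 * Real.sqrt L * (L * B))) ≤ γ / (4 * k * M ^ 2) := by
    calc _ ≤ Real.exp (-(2 * Real.log M + Real.log (4 * k / γ))) := by
          apply Real.exp_le_exp.2; linarith
      _ = _ := by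
        rw [Real.exp_neg, Real.exp_add, Real.exp_log (by positivity),
          show 2 * Real.log M = Real.log M + Real.log M by ring, Real.exp_add,
          Real.exp_log (by linarith)]
        field_simp
  rw [hexp]
  calc _ ≤ (k + 1) * N * (γ / (4 * k * M ^ 2) * (2 * N)) := by gcongr
    _ ≤ (k + k) * M * (γ / (4 * k * M ^ 2) * (2 * M)) := by gcongr
    _ = γ := by have : M ≠ 0 := by linarith
                field_simp; norm_num

/-- The power 4 is `5 / 2` rounded up to 3, plus 1 for the second logarithm. The factor 20 is `16 +
4`, using `1 ≤ E'`. -/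
theorem supply_le_polylog {n k : ℕ} {α ε γ : ℝ} (hn : 1 ≤ n) (hk : 1 ≤ k) (hα : 0 < α)
    (hα1 : α ≤ 1) (hε : 0 < ε) (hγ : 0 < γ) (hγ1 : γ ≤ 1) (hE : 1 ≤ Eprime n k α ε γ) :
    (16 * Eprime n k α ε γ + 4) / α ≤ 20 * 288 * Real.sqrt 2 * 12 ^ 3 * 6 * (1 / (α ^ 3 * ε)) *
      (1 + Real.log n + Real.log k + Real.log (1 / α) + Real.log (1 / γ)) ^ 4 := by
  have hn' : (1 : ℝ) ≤ n := by exact_mod_cast hn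
  have hk' : (1 : ℝ) ≤ k := by exact_mod_cast hk
  have h1 := Real.log_nonneg hn'
  have h2 := Real.log_nonneg hk'
  have h3 : 0 ≤ Real.log (1 / α) := Real.log_nonneg (by rw [le_div_iff₀ hα]; linarith)
  have h4 : 0 ≤ Real.log (1 / γ) := Real.log_nonneg (by rw [le_div_iff₀ hγ]; linarith)
  set X := 1 + Real.log n + Real.log k + Real.log (1 / α) + Real.log (1 / γ) with hX
  have hX1 : 1 ≤ X := by linarith
  have hα2 : α ^ 2 ≤ 1 := pow_le_one₀ hα.le hα1
  have hM : 2 ≤ 72 * n / α ^ 2 := by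
    rw [le_div_iff₀ (by positivity)]; nlinarith
  have hlog72 : Real.log 72 ≤ 6 := by
    have : Real.log 72 ≤ Real.log (2 ^ 7) := Real.log_le_log (by norm_num) (by norm_num)
    rw [Real.log_pow] at this
    push_cast at this
    linarith [Real.log_two_lt_d9]
  have hA : Real.logb 2 (72 * n / α ^ 2) ≤ 12 * X := by
    refine (logb_two_le_two_mul_log (by linarith)).trans ?_
    have : Real.log (72 * n / α ^ 2) = Real.log 72 + Real.log n + 2 * Real.log (1 / α) := by
      rw [Real.log_div (by positivity) (by positivity), Real.log_mul (by norm_num) (by positivity),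
        Real.log_pow, one_div, Real.log_inv]
      push_cast; ring
    rw [this]; linarith
  have hB : Real.logb 2 (4 * k / γ) ≤ 6 * X := by
    refine (logb_two_le_two_mul_log (by rw [le_div_iff₀ hγ]; nlinarith)).trans ?_
    have : Real.log (4 * k / γ) = 2 * Real.log 2 + Real.log k + Real.log (1 / γ) := by
      rw [Real.log_div (by positivity) (by positivity), Real.log_mul (by norm_num) (by positivity),
        show (4 : ℝ) = 2 ^ 2 by norm_num, Real.log_pow, one_div, Real.log_inv]
      push_cast; ring
    rw [this]; linarith [Real.log_two_lt_d9]
  have hA0 : 0 ≤ Real.logb 2 (72 * n / α ^ 2) := Real.logb_nonneg (by norm_num) (by linarith)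
  have hB0 := two_le_logb_four_mul_div hk hγ hγ1
  have hApow : Real.logb 2 (72 * n / α ^ 2) ^ (5 / 2 : ℝ) ≤ (12 * X) ^ 3 := by
    calc _ ≤ (12 * X) ^ (5 / 2 : ℝ) := Real.rpow_le_rpow hA0 hA (by norm_num)
      _ ≤ (12 * X) ^ ((3 : ℕ) : ℝ) :=
        Real.rpow_le_rpow_of_exponent_le (by linarith) (by norm_num)
      _ = _ := Real.rpow_natCast _ _
  have hEle : Eprime n k α ε γ ≤
      288 * Real.sqrt 2 / (α ^ 2 * ε) * (12 * X) ^ 3 * (6 * X) := by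
    rw [Eprime]; gcongr
  calc (16 * Eprime n k α ε γ + 4) / α ≤ 20 * Eprime n k α ε γ / α := by gcongr; linarith
    _ ≤ 20 * (288 * Real.sqrt 2 / (α ^ 2 * ε) * (12 * X) ^ 3 * (6 * X)) / α := by gcongr
    _ = _ := by field_simp

theorem Params.T_third (n k s : ℕ) (α ε γ : ℝ) :
    (⟨n, k, s, α / 3, α / 3, ε, γ⟩ : Params).T = 72 / α ^ 2 := by
  simp only [Params.T]; rw [div_mul_div_comm, div_div_eq_mul_div]; norm_num; ring

/-- With `T = 72 / α ^ 2`, the constant is `2√2 · 2 · 72 = 288√2`. -/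
theorem Params.E_third (n k s : ℕ) {α ε γ : ℝ} (hα : 0 < α) :
    (⟨n, k, s, α / 3, α / 3, ε, γ⟩ : Params).E = Eprime n k α ε γ := by
  simp only [Params.E, Params.ε', Params.T_third, Eprime]
  rw [show (n : ℝ) * (72 / α ^ 2) = 72 * n / α ^ 2 by ring]
  congr 2
  field_simp; norm_num

/-! ### Bidders holding a good -/

section Holders

variable {n k : ℕ}

open Classical in
/-- The bidders who hold the good `j`. -/
def holders (μ : Fin n → Slot k) (j : Fin k) : Finset (Fin n) :=
  Finset.univ.filter fun i => μ i = Slot.good j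

open Classical in
/-- The bidders who hold nothing yet. -/
def idle (μ : Fin n → Slot k) : Finset (Fin n) :=
  Finset.univ.filter fun i => μ i = Slot.empty

@[simp]
theorem mem_holders {μ : Fin n → Slot k} {j : Fin k} {i : Fin n} :
    i ∈ holders μ j ↔ μ i = Slot.good j := by simp [holders]

@[simp]
theorem mem_idle {μ : Fin n → Slot k} {i : Fin n} : i ∈ idle μ ↔ μ i = Slot.empty := by
  simp [idle]

theorem holders_update_self {μ : Fin n → Slot k} (i : Fin n) (j : Fin k) :
    holders (Function.update μ i (Slot.good j)) j = insert i (holders μ j) := by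
  ext i'; by_cases h : i' = i <;> simp [h]

theorem holders_update_of_not_good {μ : Fin n → Slot k} {i : Fin n} {j : Fin k} {e : Slot k}
    (he : e ≠ Slot.good j) : holders (Function.update μ i e) j = (holders μ j).erase i := by
  ext i'; by_cases h : i' = i <;> simp [h, he]

theorem holders_update_of_ne {μ : Fin n → Slot k} {i : Fin n} {j : Fin k} {e : Slot k}
    (he : e ≠ Slot.good j) (hi : μ i ≠ Slot.good j) :
    holders (Function.update μ i e) j = holders μ j := by
  rw [holders_update_of_not_good he, Finset.erase_eq_of_notMem (by simpa using hi)]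

theorem idle_update_empty {μ : Fin n → Slot k} (i : Fin n) :
    idle (Function.update μ i Slot.empty) = insert i (idle μ) := by
  ext i'; by_cases h : i' = i <;> simp [h]

theorem sum_card_holders_add_card_idle_le (μ : Fin n → Slot k) :
    ∑ j, (holders μ j).card + (idle μ).card ≤ n := by
  classical
  have hdisj : ((Finset.univ : Finset (Fin k)) : Set (Fin k)).PairwiseDisjoint (holders μ) := by
    intro j _ j' _ hne
    refine Finset.disjoint_left.2 fun i hi hi' => hne ?_
    rw [mem_holders] at hi hi'
    exact Slot.good.inj (hi.symm.trans hi')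
  rw [← Finset.card_biUnion hdisj, ← Finset.card_union_of_disjoint]
  · exact (Finset.card_le_univ _).trans_eq (Fintype.card_fin n)
  · refine Finset.disjoint_left.2 fun i hi hi' => ?_
    obtain ⟨j, -, hj⟩ := Finset.mem_biUnion.1 hi
    rw [mem_holders] at hj
    rw [mem_idle, hj] at hi'
    cases hi'

end Holders

/-- The supply that is not held back. -/
def Params.cap (P : Params) : ℝ := P.s - P.m

theorem Params.cap_eq (P : Params) : P.cap = P.s - 2 * P.E - 1 := by
  rw [Params.cap, Params.m]; ring

/-! ### The invariant of the bidders -/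

/-- The invariant relating the true bid counts `C`, the readings `c` and the price levels `l` (in
units of `α`) of the goods to the recorded readings `d` and the slots `μ` of the bidders. -/
structure BidderInv (P : Params) (v : Fin P.n → Fin P.k → ℝ) (C : Option (Fin P.k) → ℕ)
    (c : Fin P.k → ℝ) (l : Fin P.k → ℕ) (d : Fin P.n → ℝ) (μ : Fin P.n → Slot P.k) : Prop where
  count_le : ∀ j, P.α * C (some j) ≤ (1 + P.α) * P.cap + P.α * (P.E + 1)
  -- Each of these bids came when the true count was already at least `x - E`. Without nonemptiness
  -- this would fail for large `x`.
  card_le : ∀ j x, ((holders μ j).filter fun i => x ≤ d i).Nonempty →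
    (((holders μ j).filter fun i => x ≤ d i).card : ℝ) + x ≤ C (some j) + P.E
  -- A bidder with `d i > x ≥ c j - cap` is not yet eligible for release; the bids made at readings
  -- at most `x` number at most `x + E + 1`.
  le_card : ∀ j x, 0 ≤ x → c j - P.cap ≤ x →
    (C (some j) : ℝ) ≤ ((holders μ j).filter fun i => x < d i).card + x + P.E + 1
  d_nonneg : ∀ i j, μ i = Slot.good j → 0 ≤ d i
  -- Here `h` is the price level at the time of the bid, and utility was optimal at the lower prices
  -- of that time.
  envyFree : ∀ i j, μ i = Slot.good j → ∃ h : ℕ, d i < (h + 1) * P.cap ∧ P.α * h < v i j ∧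
    ∀ j', v i j' - P.α * l j' ≤ v i j - P.α * h
  priced_out : ∀ i, μ i = Slot.bot → ∀ j, v i j ≤ P.α * l j
  balance : C none + ∑ j, (holders μ j).card = ∑ j, C (some j)
  free_good : ∀ j, l j = 0 → C (some j) ≤ (holders μ j).card

namespace BidderInv

variable {P : Params} {v : Fin P.n → Fin P.k → ℝ} {C : Option (Fin P.k) → ℕ} {c : Fin P.k → ℝ}
  {l : Fin P.k → ℕ} {d : Fin P.n → ℝ} {μ : Fin P.n → Slot P.k}

theorem init (hα : 0 < P.α) (hE : 0 ≤ P.E) (hcap : 0 < P.cap) :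
    BidderInv P v (fun _ => 0) (fun _ => 0) (fun _ => 0) (fun _ => 0) (fun _ => Slot.empty) where
  count_le j := by simp only [Nat.cast_zero, mul_zero]; positivity
  card_le j x h := by simp [holders] at h
  le_card j x hx _ := by simp only [Nat.cast_zero]; positivity
  d_nonneg i j h := by cases h
  envyFree i j h := by cases h
  priced_out i h := by cases h
  balance := by simp [holders]
  free_good j _ := by simp

theorem mono (H : BidderInv P v C c l d μ) (hα : 0 < P.α) {c' : Fin P.k → ℝ} {l' : Fin P.k → ℕ}
    (hc : ∀ j, c j ≤ c' j) (hl : ∀ j, l j ≤ l' j) : BidderInv P v C c' l' d μ := by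
  have hp : ∀ j, P.α * l j ≤ P.α * l' j := fun j =>
    mul_le_mul_of_nonneg_left (by exact_mod_cast hl j) hα.le
  exact
  { H with
    le_card := fun j x h0 hx => H.le_card j x h0 (by linarith [hc j])
    envyFree := fun i j hij => by
      obtain ⟨h, h1, h2, h3⟩ := H.envyFree i j hij
      exact ⟨h, h1, h2, fun j' => by linarith [h3 j', hp j']⟩
    priced_out := fun i hi j => (H.priced_out i hi j).trans (hp j)
    free_good := fun j hj => H.free_good j (by have := hl j; omega) }

theorem setBot (H : BidderInv P v C c l d μ) {i : Fin P.n} (hi : μ i = Slot.empty)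
    (hv : ∀ j, v i j ≤ P.α * l j) :
    BidderInv P v C c l d (Function.update μ i Slot.bot) := by
  have hh : ∀ j, holders (Function.update μ i Slot.bot) j = holders μ j := fun j =>
    holders_update_of_ne (by simp) (by simp [hi])
  have hg : ∀ i' j, Function.update μ i Slot.bot i' = Slot.good j → μ i' = Slot.good j := by
    intro i' j h
    by_cases hii : i' = i
    · subst hii; simp at h
    · rwa [Function.update_of_ne hii] at h
  exact
  { count_le := H.count_le
    card_le := by simpa only [hh] using H.card_le
    le_card := by simpa only [hh] using H.le_card
    d_nonneg := fun i' j h => H.d_nonneg i' j (hg i' j h)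
    envyFree := fun i' j h => H.envyFree i' j (hg i' j h)
    priced_out := fun i' h => by
      by_cases hii : i' = i
      · subst hii; exact hv
      · rw [Function.update_of_ne hii] at h; exact H.priced_out i' h
    balance := by simpa only [hh] using H.balance
    free_good := by simpa only [hh] using H.free_good }

theorem assign (H : BidderInv P v C c l d μ) (hα : 0 < P.α) {i : Fin P.n} {j : Fin P.k}
    (hi : μ i = Slot.empty) (hcap : 0 < P.cap) (hv1 : v i j ≤ 1)
    (hcC : c j ≤ C (some j) + P.E) (hCc : C (some j) ≤ c j + P.E) (hlc : l j * P.cap ≤ c j)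
    (hcl : c j < (l j + 1) * P.cap) (hpos : P.α * l j < v i j)
    (hmax : ∀ j', v i j' - P.α * l j' ≤ v i j - P.α * l j) :
    BidderInv P v (Function.update C (some j) (C (some j) + 1)) c l
      (Function.update d i (c j)) (Function.update μ i (Slot.good j)) := by
  have hni : i ∉ holders μ j := by simp [hi]
  have hself := holders_update_self (μ := μ) i j
  have hother : ∀ j', j' ≠ j → holders (Function.update μ i (Slot.good j)) j' = holders μ j' :=
    fun j' hj => holders_update_of_ne (by simpa using hj.symm) (by simp [hi])
  have hC : ∀ j', j' ≠ j →
      Function.update C (some j) (C (some j) + 1) (some j') = C (some j') := fun j' hj =>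
    Function.update_of_ne (by simpa using hj) _ _
  have hfo : ∀ (p : ℝ → Prop) [DecidablePred p] (j' : Fin P.k),
      ((holders μ j').filter fun i' => p (Function.update d i (c j) i')) =
        (holders μ j').filter fun i' => p (d i') := by
    intro p _ j'
    refine Finset.filter_congr fun i' hi' => ?_
    have : i' ≠ i := by rintro rfl; simp [hi] at hi'
    rw [Function.update_of_ne this]
  have hfs : ∀ (p : ℝ → Prop) [DecidablePred p],
      ((insert i (holders μ j)).filter fun i' => p (Function.update d i (c j) i')) =
        if p (c j) then insert i ((holders μ j).filter fun i' => p (d i'))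
        else (holders μ j).filter fun i' => p (d i') := by
    intro p _
    rw [Finset.filter_insert, hfo, Function.update_self]
  have hc0 : 0 ≤ c j := le_trans (by positivity) hlc
  refine ⟨?_, ?_, ?_, ?_, ?_, ?_, ?_, ?_⟩
  · intro j'
    by_cases hj : j' = j
    · subst hj
      rw [Function.update_self]
      push_cast
      have h1 : P.α * (C (some j') : ℝ) ≤ P.α * ((l j' + 1) * P.cap + P.E) :=
        mul_le_mul_of_nonneg_left (by linarith) hα.le
      -- The bid was made at a price below the value, hence below 1; this caps the level and so the
      -- number of bids.
      have h2 : P.α * l j' * P.cap ≤ 1 * P.cap :=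
        mul_le_mul_of_nonneg_right (by linarith) hcap.le
      linarith
    · rw [hC j' hj]; exact H.count_le j'
  · intro j' x hne
    by_cases hj : j' = j
    · subst hj
      rw [hself, hfs (fun y => x ≤ y)] at hne ⊢
      rw [Function.update_self]
      push_cast
      split_ifs at hne ⊢ with hx
      · rw [Finset.card_insert_of_notMem fun h => hni (Finset.mem_of_mem_filter _ h)]
        push_cast
        rcases Finset.eq_empty_or_nonempty ((holders μ j').filter fun i => x ≤ d i) with h0 | h0
        · rw [h0, Finset.card_empty, Nat.cast_zero]; linarith
        · linarith [H.card_le j' x h0]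
      · linarith [H.card_le j' x hne]
    · rw [hother j' hj, hfo (fun y => x ≤ y)] at hne ⊢
      rw [hC j' hj]; exact H.card_le j' x hne
  · intro j' x h0 hx
    by_cases hj : j' = j
    · subst hj
      rw [hself, hfs (fun y => x < y), Function.update_self]
      push_cast
      split_ifs with hxc
      · rw [Finset.card_insert_of_notMem fun h => hni (Finset.mem_of_mem_filter _ h)]
        push_cast
        linarith [H.le_card j' x h0 hx]
      -- The new bid comes at a reading at most `x`, so the count before it is at most `x + E`,
      -- whoever still holds the good.
      · have : (0 : ℝ) ≤ ((holders μ j').filter fun i => x < d i).card := Nat.cast_nonneg _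
        linarith
    · rw [hother j' hj, hfo (fun y => x < y), hC j' hj]; exact H.le_card j' x h0 hx
  · intro i' j' h
    by_cases hii : i' = i
    · subst hii; simpa using hc0
    · rw [Function.update_of_ne hii] at h ⊢; exact H.d_nonneg i' j' h
  · intro i' j' h
    by_cases hii : i' = i
    · subst hii
      rw [Function.update_self] at h ⊢
      obtain rfl := Slot.good.inj h
      exact ⟨l j, hcl, hpos, hmax⟩
    · rw [Function.update_of_ne hii] at h ⊢; exact H.envyFree i' j' h
  · intro i' h
    by_cases hii : i' = i
    · subst hii; simp at h
    · rw [Function.update_of_ne hii] at h; exact H.priced_out i' h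
  · rw [← Finset.add_sum_erase _ _ (Finset.mem_univ j), hself, Finset.card_insert_of_notMem hni,
      Finset.sum_congr rfl fun j' hj' => congrArg _ (hother j' (Finset.ne_of_mem_erase hj'))]
    conv_rhs => rw [← Finset.add_sum_erase _ _ (Finset.mem_univ j), Function.update_self,
      Finset.sum_congr rfl fun j' hj' => hC j' (Finset.ne_of_mem_erase hj')]
    have hb := H.balance
    rw [← Finset.add_sum_erase _ _ (Finset.mem_univ j)] at hb
    conv_rhs at hb => rw [← Finset.add_sum_erase _ _ (Finset.mem_univ j)]
    rw [Function.update_of_ne (by simp)]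
    omega
  · intro j' hl
    by_cases hj : j' = j
    · subst hj
      rw [hself, Finset.card_insert_of_notMem hni, Function.update_self]
      exact Nat.succ_le_succ (H.free_good j' hl)
    · rw [hC j' hj, hother j' hj]; exact H.free_good j' hl

theorem release (H : BidderInv P v C c l d μ) {i : Fin P.n} {j : Fin P.k}
    (hi : μ i = Slot.good j) (hcl : c j < (l j + 1) * P.cap) (hd : P.cap ≤ c j - d i) :
    BidderInv P v (Function.update C none (C none + 1)) c l d
      (Function.update μ i Slot.empty) := by
  have hC : ∀ j', Function.update C none (C none + 1) (some j') = C (some j') := fun j' =>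
    Function.update_of_ne (by simp) _ _
  have hmem : i ∈ holders μ j := by simp [hi]
  have hself : holders (Function.update μ i Slot.empty) j = (holders μ j).erase i :=
    holders_update_of_not_good (by simp)
  have hother : ∀ j', j' ≠ j → holders (Function.update μ i Slot.empty) j' = holders μ j' :=
    fun j' hj => holders_update_of_ne (by simp) (by simpa [hi] using hj.symm)
  have hg : ∀ i' j, Function.update μ i Slot.empty i' = Slot.good j → μ i' = Slot.good j := by
    intro i' j h
    by_cases hii : i' = i
    · subst hii; simp at h
    · rwa [Function.update_of_ne hii] at h
  have hsub : ∀ j', holders (Function.update μ i Slot.empty) j' ⊆ holders μ j' := fun j' i' h =>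
    mem_holders.2 (hg i' j' (mem_holders.1 h))
  refine ⟨?_, ?_, ?_, fun i' j h => H.d_nonneg i' j (hg i' j h),
    fun i' j h => H.envyFree i' j (hg i' j h), ?_, ?_, ?_⟩
  · simpa only [hC] using H.count_le
  · intro j' x hne
    have hss := Finset.filter_subset_filter (fun i => x ≤ d i) (hsub j')
    rw [hC]
    refine le_trans ?_ (H.card_le j' x (hne.mono hss))
    have := Finset.card_le_card hss
    gcongr
  · intro j' x h0 hx
    rw [hC]
    by_cases hj : j' = j
    · subst hj
      rw [hself, Finset.filter_erase, Finset.erase_eq_of_notMem]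
      · exact H.le_card j' x h0 hx
      -- The released bidder has `d i ≤ c j - cap ≤ x`, so he was not counted.
      · simp only [Finset.mem_filter, not_and, not_lt]
        intro _; linarith
    · rw [hother j' hj]; exact H.le_card j' x h0 hx
  · intro i' h
    by_cases hii : i' = i
    · subst hii; simp at h
    · rw [Function.update_of_ne hii] at h; exact H.priced_out i' h
  · rw [Function.update_self, Finset.sum_congr rfl fun j' _ => hC j', ← H.balance,
      ← Finset.add_sum_erase _ _ (Finset.mem_univ j), hself,
      Finset.sum_congr rfl fun j' hj' => congrArg _ (hother j' (Finset.ne_of_mem_erase hj'))]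
    conv_rhs => rw [← Finset.add_sum_erase _ _ (Finset.mem_univ j)]
    have := Finset.card_erase_add_one hmem
    omega
  · intro j' hl
    by_cases hj : j' = j
    · subst hj
      -- At price level 0 the reading is below `cap` and `d i ≥ 0`, so no release can occur.
      rw [hl] at hcl
      have := H.d_nonneg i j' hi
      push_cast at hcl
      linarith
    · rw [hC, hother j' hj]; exact H.free_good j' hl

end BidderInv

/-! ### The invariant of the algorithm -/

/-- The invariant relating the counters, readings and prices of a state to the true counts `C` and
the price levels `l`; `τ` and `τ₀` are the numbers of items read by the counters of the goods and
by counter(0). -/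
structure CounterInv (P : Params) (ω : Noise P.k) (S : State P.n P.k) (C : Option (Fin P.k) → ℕ)
    (l : Fin P.k → ℕ) (τ τ₀ : ℕ) : Prop where
  accurate : ∀ q, (S.ctr q).Accurate (fun t => ω (q, t)) P.E (C q)
  time_some : ∀ j, (S.ctr (some j)).time = τ
  time_none : (S.ctr none).time = τ₀
  c_eq : ∀ j, S.c j = (S.ctr (some j)).out
  p_eq : ∀ j, S.p j = P.α * l j
  le_c : ∀ j, l j * P.cap ≤ S.c j
  c_lt : ∀ j, S.c j < (l j + 1) * P.cap

/-- The invariant of the algorithm. -/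
structure Inv (P : Params) (v : Fin P.n → Fin P.k → ℝ) (ω : Noise P.k) (S : State P.n P.k)
    (C : Option (Fin P.k) → ℕ) (l : Fin P.k → ℕ) (τ τ₀ : ℕ) : Prop where
  counters : CounterInv P ω S C l τ τ₀
  bidders : BidderInv P v C S.c l S.d S.μ

/-- The conditions on the parameters under which the invariant is preserved. -/
structure Params.Admissible (P : Params) : Prop where
  α_pos : 0 < P.α
  E_nonneg : 0 ≤ P.E
  m_lt_cap : P.m < P.cap

theorem Params.Admissible.cap_pos {P : Params} (hP : P.Admissible) : 0 < P.cap := by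
  have h1 := hP.E_nonneg
  have h2 := hP.m_lt_cap
  rw [Params.m] at h2
  linarith

section Algorithm

variable {P : Params} {v : Fin P.n → Fin P.k → ℝ} {tie : ℕ → Fin P.n → (Fin P.k → ℝ) → Fin P.k}
  {ω : Noise P.k} {S : State P.n P.k} {C : Option (Fin P.k) → ℕ} {l : Fin P.k → ℕ} {τ τ₀ N : ℕ}

theorem CounterInv.reading_le (H : CounterInv P ω S C l τ τ₀) (j : Fin P.k) :
    S.c j ≤ C (some j) + P.E := by
  rw [H.c_eq]; exact (H.accurate (some j)).out_le

theorem CounterInv.count_le (H : CounterInv P ω S C l τ τ₀) (j : Fin P.k) :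
    (C (some j) : ℝ) ≤ S.c j + P.E := by
  rw [H.c_eq]; linarith [(H.accurate (some j)).le_out]

theorem GoodNoise.abs_noiseSum_le (hω : GoodNoise P.k P.E N ω) (q : Option (Fin P.k)) {t : ℕ}
    (ht : t + 1 ≤ N) : |noiseSum (fun u => ω (q, u)) (t + 1)| ≤ P.E :=
  hω q (t + 1) (Finset.mem_Icc.2 ⟨by omega, ht⟩)

theorem Inv.init (hP : P.Admissible) :
    Inv P v ω (State.init P.n P.k) (fun _ => 0) (fun _ => 0) 0 0 where
  counters :=
    { accurate := fun q => by
        simpa [State.init] using CounterState.accurate_init (fun t => ω (q, t)) hP.E_nonneg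
      time_some := fun _ => rfl
      time_none := rfl
      c_eq := fun _ => rfl
      p_eq := fun _ => by simp [State.init]
      le_c := fun _ => by simp [State.init]
      c_lt := fun _ => by simpa [State.init] using hP.cap_pos }
  bidders := BidderInv.init hP.α_pos hP.E_nonneg hP.cap_pos

/-- The effect of **Bid** on the counters and prices. -/
theorem CounterInv.bid (hP : P.Admissible) (hω : GoodNoise P.k P.E N ω)
    (H : CounterInv P ω S C l τ τ₀) (hτ : τ + 1 ≤ N) {b : Fin P.k → ℝ}
    {C' : Option (Fin P.k) → ℕ} (hb0 : ∀ j, 0 ≤ b j) (hb1 : ∀ j, b j ≤ 1)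
    (hC : ∀ j, (C' (some j) : ℝ) = C (some j) + b j) (hnone : C' none = C none) :
    ∃ l', CounterInv P ω (bid P ω b S) C' l' (τ + 1) τ₀ ∧ (∀ j, l j ≤ l' j) ∧
      ∀ j, S.c j ≤ (bid P ω b S).c j := by
  have hacc : ∀ j, ((S.ctr (some j)).feed (fun t => ω (some j, t)) (b j)).Accurate
      (fun t => ω (some j, t)) P.E (C' (some j)) := fun j => by
    rw [hC]
    refine (H.accurate (some j)).feed (hb0 j) ?_
    rw [H.time_some]
    exact hω.abs_noiseSum_le (some j) hτ
  have hmono : ∀ j, S.c j ≤ (PrivMatch.bid P ω b S).c j := fun j => by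
    rw [H.c_eq]
    exact CounterState.out_le_feed (fun t => ω (some j, t)) (b j) (S.ctr (some j))
  -- The reserve is `2E + 1` for this reason: a counter error at each end plus one true bid. As `m <
  -- cap`, no price level is skipped.
  have hjump : ∀ j, (PrivMatch.bid P ω b S).c j ≤ S.c j + P.m := fun j => by
    have h1 : (PrivMatch.bid P ω b S).c j ≤ C' (some j) + P.E := (hacc j).out_le
    rw [hC] at h1
    rw [Params.m]
    linarith [H.count_le j, hb1 j]
  have hcond : ∀ j, (S.p j / P.α + 1) * (P.s - P.m) = (l j + 1) * P.cap := fun j => by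
    rw [H.p_eq, mul_div_cancel_left₀ _ hP.α_pos.ne', Params.cap]
  have hp : ∀ j, (PrivMatch.bid P ω b S).p j =
      if (l j + 1) * P.cap ≤ (PrivMatch.bid P ω b S).c j then S.p j + P.α else S.p j := fun j => by
    rw [← hcond]; rfl
  refine ⟨fun j => if (l j + 1) * P.cap ≤ (PrivMatch.bid P ω b S).c j then l j + 1 else l j,
    ⟨?_, ?_, H.time_none, fun _ => rfl, ?_, ?_, ?_⟩, ?_, hmono⟩
  · rintro (_ | j)
    · rw [hnone]; exact H.accurate none
    · exact hacc j
  · intro j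
    change (S.ctr (some j)).time + 1 = τ + 1
    rw [H.time_some]
  · intro j
    rw [hp, H.p_eq]
    split_ifs
    · push_cast; ring
    · rfl
  · intro j
    split_ifs with h
    · push_cast; exact h
    · exact (H.le_c j).trans (hmono j)
  · intro j
    split_ifs with h
    · push_cast
      have := H.c_lt j
      linarith [hjump j, hP.m_lt_cap]
    · exact not_le.1 h
  · intro j
    dsimp only
    split_ifs <;> omega

/-- The turn of a bidder who does not bid on a good. -/
theorem Inv.bid_zero (hP : P.Admissible) (hω : GoodNoise P.k P.E N ω)
    (H : Inv P v ω S C l τ τ₀) (hτ : τ + 1 ≤ N) :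
    ∃ l', Inv P v ω (bid P ω (fun _ => 0) S) C l' (τ + 1) τ₀ := by
  obtain ⟨l', h1, h2, h3⟩ := H.counters.bid hP hω hτ (b := fun _ => 0) (C' := C)
    (fun _ => le_rfl) (fun _ => zero_le_one) (fun _ => by simp) rfl
  exact ⟨l', h1, H.bidders.mono hP.α_pos h3 h2⟩

theorem Inv.proposeStep (hP : P.Admissible) (hω : GoodNoise P.k P.E N ω)
    (hv : ∀ i j, v i j ≤ 1) (htie : IsTieRule tie) (H : Inv P v ω S C l τ τ₀) (hτ : τ + 1 ≤ N)
    (r : ℕ) (i : Fin P.n) :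
    ∃ C' l', Inv P v ω (proposeStep P v tie ω r S i) C' l' (τ + 1) τ₀ ∧ C' none = C none ∧
      (proposeStep P v tie ω r S i).μ i ≠ Slot.empty ∧
      ∀ i', S.μ i' ≠ Slot.empty → (proposeStep P v tie ω r S i).μ i' ≠ Slot.empty := by
  cases hi : S.μ i with
  | empty =>
    have hmax := htie r i fun j => v i j - S.p j
    rw [PrivMatch.proposeStep, hi]
    dsimp only
    generalize tie r i (fun j => v i j - S.p j) = j at hmax ⊢
    simp only [H.counters.p_eq] at hmax ⊢
    split_ifs with hle
    · have H' : Inv P v ω { S with μ := Function.update S.μ i Slot.bot } C l τ τ₀ :=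
        ⟨⟨H.counters.accurate, H.counters.time_some, H.counters.time_none, H.counters.c_eq,
          H.counters.p_eq, H.counters.le_c, H.counters.c_lt⟩,
          H.bidders.setBot hi fun j' => by linarith [hmax j']⟩
      obtain ⟨l', h⟩ := H'.bid_zero hP hω hτ
      refine ⟨C, l', h, rfl, by simp [PrivMatch.bid], fun i' hi' => ?_⟩
      by_cases hii : i' = i
      · subst hii; exact absurd hi hi'
      · simpa [PrivMatch.bid, hii] using hi'
    · have hK : CounterInv P ω { S with
          μ := Function.update S.μ i (Slot.good j), d := Function.update S.d i (S.c j) }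
          C l τ τ₀ :=
        ⟨H.counters.accurate, H.counters.time_some, H.counters.time_none, H.counters.c_eq,
          H.counters.p_eq, H.counters.le_c, H.counters.c_lt⟩
      have hB := H.bidders.assign hP.α_pos hi hP.cap_pos (hv i j) (H.counters.reading_le j)
        (H.counters.count_le j) (H.counters.le_c j) (H.counters.c_lt j) (by linarith) hmax
      obtain ⟨l', h1, h2, h3⟩ := hK.bid hP hω hτ (b := Pi.single j 1)
        (C' := Function.update C (some j) (C (some j) + 1))
        (fun j' => by by_cases h : j' = j <;> simp [h])
        (fun j' => by by_cases h : j' = j <;> simp [h])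
        (fun j' => by by_cases h : j' = j <;> simp [h])
        (Function.update_of_ne (by simp) _ _)
      refine ⟨_, l', ⟨h1, hB.mono hP.α_pos h3 h2⟩, Function.update_of_ne (by simp) _ _,
        by simp [PrivMatch.bid], fun i' hi' => ?_⟩
      by_cases hii : i' = i
      · subst hii; exact absurd hi hi'
      · simpa [PrivMatch.bid, hii] using hi'
  | bot =>
    obtain ⟨l', h⟩ := H.bid_zero hP hω hτ
    rw [PrivMatch.proposeStep, hi]
    exact ⟨C, l', h, rfl, by simp [PrivMatch.bid, hi], fun i' hi' => hi'⟩
  | good j =>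
    obtain ⟨l', h⟩ := H.bid_zero hP hω hτ
    rw [PrivMatch.proposeStep, hi]
    exact ⟨C, l', h, rfl, by simp [PrivMatch.bid, hi], fun i' hi' => hi'⟩

theorem Inv.foldl_proposeStep (hP : P.Admissible) (hω : GoodNoise P.k P.E N ω)
    (hv : ∀ i j, v i j ≤ 1) (htie : IsTieRule tie) (r : ℕ) (L : List (Fin P.n)) :
    ∀ {S C l τ}, Inv P v ω S C l τ τ₀ → τ + L.length ≤ N →
    ∃ C' l', Inv P v ω (L.foldl (PrivMatch.proposeStep P v tie ω r) S) C' l' (τ + L.length) τ₀ ∧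
      C' none = C none ∧
      (∀ i ∈ L, (L.foldl (PrivMatch.proposeStep P v tie ω r) S).μ i ≠ Slot.empty) ∧
      ∀ i, S.μ i ≠ Slot.empty →
        (L.foldl (PrivMatch.proposeStep P v tie ω r) S).μ i ≠ Slot.empty := by
  induction L with
  | nil => exact fun {S C l τ} H _ => ⟨C, l, H, rfl, by simp, fun i hi => hi⟩
  | cons i L ih =>
    intro S C l τ H hτ
    rw [List.length_cons] at hτ
    obtain ⟨C₁, l₁, H₁, hC₁, hi₁, hk₁⟩ := H.proposeStep hP hω hv htie (by omega) r i
    obtain ⟨C₂, l₂, H₂, hC₂, hi₂, hk₂⟩ := ih H₁ (by omega)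
    rw [List.foldl_cons, List.length_cons]
    refine ⟨C₂, l₂, ?_, hC₂.trans hC₁, ?_, fun i' hi' => hk₂ i' (hk₁ i' hi')⟩
    · rwa [show τ + (L.length + 1) = τ + 1 + L.length by omega]
    · intro i' hi'
      rcases List.mem_cons.1 hi' with rfl | h
      · exact hk₂ _ hi₁
      · exact hi₂ _ h

/-- The bidder `i` is satisfied with what he holds. -/
def Satisfied (P : Params) (S : State P.n P.k) (i : Fin P.n) : Prop :=
  ∀ j, S.μ i = Slot.good j → S.c j - S.d i < P.cap

theorem CounterInv.feedZero (hω : GoodNoise P.k P.E N ω) (H : CounterInv P ω S C l τ τ₀)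
    (hτ : τ₀ + 1 ≤ N) {σ : ℕ} :
    CounterInv P ω (feedZero P ω σ S) (Function.update C none (C none + σ)) l τ (τ₀ + 1) := by
  refine ⟨?_, ?_, ?_, ?_, H.p_eq, H.le_c, H.c_lt⟩
  · rintro (_ | j)
    · simp only [PrivMatch.feedZero, Function.update_self, Nat.cast_add]
      refine (H.accurate none).feed (Nat.cast_nonneg σ) ?_
      rw [H.time_none]
      exact hω.abs_noiseSum_le none hτ
    · simpa [PrivMatch.feedZero] using H.accurate (some j)
  · intro j; simpa [PrivMatch.feedZero] using H.time_some j
  · simp [PrivMatch.feedZero, CounterState.feed, H.time_none]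
  · intro j; simpa [PrivMatch.feedZero] using H.c_eq j

theorem Inv.feedZero_zero (hω : GoodNoise P.k P.E N ω) (H : Inv P v ω S C l τ τ₀)
    (hτ : τ₀ + 1 ≤ N) : Inv P v ω (feedZero P ω 0 S) C l τ (τ₀ + 1) := by
  have h := H.counters.feedZero hω hτ (σ := 0)
  rw [add_zero, Function.update_eq_self, Nat.cast_zero] at h
  exact ⟨h, H.bidders⟩

theorem Inv.countStep (hω : GoodNoise P.k P.E N ω) (H : Inv P v ω S C l τ τ₀) (hτ : τ₀ + 1 ≤ N)
    (i : Fin P.n) :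
    ∃ C', Inv P v ω (countStep P ω S i) C' l τ (τ₀ + 1) ∧
      C' none + (idle S.μ).card = C none + (idle (countStep P ω S i).μ).card ∧
      Satisfied P (countStep P ω S i) i ∧
      ∀ i', Satisfied P S i' → Satisfied P (countStep P ω S i) i' := by
  cases hi : S.μ i with
  | empty =>
    rw [PrivMatch.countStep, hi]
    exact ⟨C, H.feedZero_zero hω hτ, rfl, fun j h => by simp [feedZero, hi] at h,
      fun i' h => h⟩
  | bot =>
    rw [PrivMatch.countStep, hi]
    exact ⟨C, H.feedZero_zero hω hτ, rfl, fun j h => by simp [feedZero, hi] at h,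
      fun i' h => h⟩
  | good j =>
    rw [PrivMatch.countStep, hi]
    dsimp only
    split_ifs with hd
    · have hK : CounterInv P ω { S with μ := Function.update S.μ i Slot.empty } C l τ τ₀ :=
        ⟨H.counters.accurate, H.counters.time_some, H.counters.time_none, H.counters.c_eq,
          H.counters.p_eq, H.counters.le_c, H.counters.c_lt⟩
      have h := hK.feedZero hω hτ (σ := 1)
      rw [Nat.cast_one] at h
      refine ⟨_, ⟨h, H.bidders.release hi (H.counters.c_lt j) hd⟩, ?_, ?_, ?_⟩
      · simp only [feedZero, Function.update_self, idle_update_empty]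
        rw [Finset.card_insert_of_notMem (by simp [hi])]
        omega
      · intro j' h
        simp [feedZero] at h
      · intro i' hs j' h
        by_cases hii : i' = i
        · subst hii; simp [feedZero] at h
        · simp only [feedZero, Function.update_of_ne hii] at h
          exact hs j' h
    · refine ⟨C, H.feedZero_zero hω hτ, rfl, fun j' h => ?_, fun i' h => h⟩
      obtain rfl := Slot.good.inj (hi.symm.trans h)
      exact not_le.1 hd

theorem Inv.foldl_countStep (hω : GoodNoise P.k P.E N ω) (L : List (Fin P.n)) :
    ∀ {S C τ₀}, Inv P v ω S C l τ τ₀ → τ₀ + L.length ≤ N →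
    ∃ C', Inv P v ω (L.foldl (PrivMatch.countStep P ω) S) C' l τ (τ₀ + L.length) ∧
      C' none + (idle S.μ).card =
        C none + (idle (L.foldl (PrivMatch.countStep P ω) S).μ).card ∧
      (∀ i ∈ L, Satisfied P (L.foldl (PrivMatch.countStep P ω) S) i) ∧
      ∀ i, Satisfied P S i → Satisfied P (L.foldl (PrivMatch.countStep P ω) S) i := by
  induction L with
  | nil => exact fun {S C τ₀} H _ => ⟨C, H, rfl, by simp, fun i hi => hi⟩
  | cons i L ih =>
    intro S C τ₀ H hτ
    rw [List.length_cons] at hτ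
    obtain ⟨C₁, H₁, hC₁, hi₁, hk₁⟩ := H.countStep hω (by omega) i
    obtain ⟨C₂, H₂, hC₂, hi₂, hk₂⟩ := ih H₁ (by omega)
    rw [List.foldl_cons, List.length_cons]
    refine ⟨C₂, ?_, by omega, ?_, fun i' hi' => hk₂ i' (hk₁ i' hi')⟩
    · rwa [show τ₀ + (L.length + 1) = τ₀ + 1 + L.length by omega]
    · intro i' hi'
      rcases List.mem_cons.1 hi' with rfl | h
      · exact hk₂ _ hi₁
      · exact hi₂ _ h

/-- After a full round, every bidder is satisfied, and the true count of counter(0) has increased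
by the number of bidders who hold nothing. -/
theorem Inv.fullRound (hP : P.Admissible) (hω : GoodNoise P.k P.E N ω)
    (hv : ∀ i j, v i j ≤ 1) (htie : IsTieRule tie) (H : Inv P v ω S C l τ τ₀) (r : ℕ)
    (hτ : τ + P.n ≤ N) (hτ₀ : τ₀ + P.n ≤ N) :
    ∃ C' l', Inv P v ω (fullRound P v tie ω r S) C' l' (τ + P.n) (τ₀ + P.n) ∧
      C' none = C none + (idle (fullRound P v tie ω r S).μ).card ∧
      ∀ i, Satisfied P (fullRound P v tie ω r S) i := by
  have hlen : (List.finRange P.n).length = P.n := List.length_finRange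
  obtain ⟨C₁, l₁, H₁, hC₁, hi₁, -⟩ :=
    H.foldl_proposeStep hP hω hv htie r (List.finRange P.n) (by rwa [hlen])
  obtain ⟨C₂, H₂, hC₂, hi₂, -⟩ := H₁.foldl_countStep hω (List.finRange P.n) (by rwa [hlen])
  rw [hlen] at H₂
  -- Nobody is left empty after the proposals, so the idle bidders at the end of the round are
  -- exactly those released in it.
  have hidle : idle ((List.finRange P.n).foldl (PrivMatch.proposeStep P v tie ω r) S).μ = ∅ :=
    Finset.eq_empty_of_forall_notMem fun i hi => hi₁ i (List.mem_finRange i) (mem_idle.1 hi)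
  rw [hidle, Finset.card_empty, add_zero, hC₁] at hC₂
  exact ⟨C₂, l₁, H₂, hC₂, fun i => hi₂ i (List.mem_finRange i)⟩

/-- The algorithm either halts with few unsatisfied bidders or uses all its rounds; in the latter
case the reading of counter(0) has become large. -/
theorem Inv.run (hP : P.Admissible) (hω : GoodNoise P.k P.E N ω)
    (hv : ∀ i j, v i j ≤ 1) (htie : IsTieRule tie) (fuel : ℕ) :
    ∀ {r S C l}, Inv P v ω S C l (P.n * r) (P.n * r) → P.n * (r + fuel) ≤ N →
    r * (P.ρ * P.n - 2 * P.E) ≤ (S.ctr none).out →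
    ∃ C' l' τ, Inv P v ω (run P v tie ω fuel r S) C' l' τ τ ∧
      (((∀ i, Satisfied P (run P v tie ω fuel r S) i) ∧
        ((idle (run P v tie ω fuel r S).μ).card : ℝ) < P.ρ * P.n) ∨
      ((r + fuel : ℕ) : ℝ) * (P.ρ * P.n - 2 * P.E) ≤
        ((run P v tie ω fuel r S).ctr none).out) := by
  induction fuel with
  | zero => exact fun {r S C l} H _ hr => ⟨C, l, _, H, Or.inr hr⟩
  | succ fuel ih =>
    intro r S C l H hN hr
    have hle : P.n * r + P.n ≤ N := le_trans (by nlinarith) hN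
    obtain ⟨C₁, l₁, H₁, hC₁, hs₁⟩ := H.fullRound hP hω hv htie r hle hle
    rw [PrivMatch.run]
    split_ifs with hhalt
    · refine ⟨C₁, l₁, _, H₁, Or.inl ⟨hs₁, ?_⟩⟩
      -- Both readings of counter(0) are off by at most `E`, so a rise below `ρn - 2E` means fewer
      -- than `ρn` true releases.
      have h1 := (H.counters.accurate none).out_le
      have h2 := (H₁.counters.accurate none).le_out
      rw [hC₁] at h2
      push_cast at h2
      linarith
    · have := ih (r := r + 1) (S := PrivMatch.fullRound P v tie ω r S) (C := C₁) (l := l₁)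
        (by rwa [mul_add, mul_one]) (by rwa [add_assoc, add_comm 1]) (by push_cast; linarith)
      rwa [show r + 1 + fuel = r + (fuel + 1) by omega] at this

end Algorithm

/-! ### Consequences of the invariant -/

section Final

variable {P : Params} {v : Fin P.n → Fin P.k → ℝ} {ω : Noise P.k} {S : State P.n P.k}
  {C : Option (Fin P.k) → ℕ} {l : Fin P.k → ℕ} {τ τ₀ : ℕ}

/-- The goods with a positive price. -/
def pricedGoods {k : ℕ} (l : Fin k → ℕ) : Finset (Fin k) := Finset.univ.filter fun j => l j ≠ 0

/-- Apply `card_le` at the smallest recorded reading: every holder counts, and that earliest holder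
being satisfied bounds the later bids. -/
theorem Inv.card_holders_lt (H : Inv P v ω S C l τ τ₀) (hs : ∀ i, Satisfied P S i) {j : Fin P.k}
    (hne : (holders S.μ j).Nonempty) : ((holders S.μ j).card : ℝ) < P.cap + 2 * P.E := by
  obtain ⟨i, hi, hmin⟩ := Finset.exists_min_image (holders S.μ j) S.d hne
  have hall : (holders S.μ j).filter (fun i' => S.d i ≤ S.d i') = holders S.μ j :=
    Finset.filter_true_of_mem hmin
  have h1 := H.bidders.card_le j (S.d i) (by rwa [hall])
  rw [hall] at h1
  linarith [hs i j (mem_holders.1 hi), H.counters.count_le j]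

theorem State.assignment_eq_some {n k : ℕ} {S : State n k} {i : Fin n} {j : Fin k} :
    S.assignment i = some j ↔ S.μ i = Slot.good j := by
  unfold State.assignment
  cases h : S.μ i <;> simp

theorem filter_assignment_eq_holders {n k : ℕ} (S : State n k) (j : Fin k) :
    (Finset.univ.filter fun i => S.assignment i = some j) = holders S.μ j := by
  ext i; simp [State.assignment_eq_some]

theorem Inv.isMatching (H : Inv P v ω S C l τ τ₀) (hs : ∀ i, Satisfied P S i) :
    IsMatching P.s S.assignment := by
  intro j
  rw [filter_assignment_eq_holders]
  rcases Finset.eq_empty_or_nonempty (holders S.μ j) with h | h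
  · simp [h]
  · have h1 := H.card_holders_lt hs h
    rw [Params.cap_eq] at h1
    have : ((holders S.μ j).card : ℝ) ≤ P.s := by linarith
    exact_mod_cast this

/-- A positive price means that the reading has reached `cap`, so `le_card` applies at `x = c j -
cap`: the last `cap` or so bids are still held. -/
theorem Inv.le_card_holders (hP : P.Admissible) (H : Inv P v ω S C l τ τ₀) {j : Fin P.k}
    (hl : l j ≠ 0) : P.cap - 2 * P.E - 1 ≤ (holders S.μ j).card := by
  have hc : P.cap ≤ S.c j := by
    have h1 : (1 : ℝ) ≤ l j := by exact_mod_cast Nat.one_le_iff_ne_zero.2 hl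
    nlinarith [H.counters.le_c j, hP.cap_pos]
  have h1 := H.bidders.le_card j (S.c j - P.cap) (by linarith) le_rfl
  have h2 : (((holders S.μ j).filter fun i => S.c j - P.cap < S.d i).card : ℝ) ≤
      (holders S.μ j).card := by exact_mod_cast Finset.card_filter_le _ _
  linarith [H.counters.reading_le j]

theorem Inv.card_pricedGoods_mul_le (hP : P.Admissible) (H : Inv P v ω S C l τ τ₀) :
    ((pricedGoods l).card : ℝ) * (P.cap - 2 * P.E - 1) ≤ P.n - (idle S.μ).card := by
  have h1 : ((pricedGoods l).card : ℝ) * (P.cap - 2 * P.E - 1) ≤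
      ∑ j ∈ pricedGoods l, ((holders S.μ j).card : ℝ) := by
    rw [← nsmul_eq_mul]
    refine Finset.card_nsmul_le_sum _ _ _ fun j hj => H.le_card_holders hP ?_
    simpa [pricedGoods] using hj
  have h2 : ∑ j ∈ pricedGoods l, ((holders S.μ j).card : ℝ) ≤ ∑ j, ((holders S.μ j).card : ℝ) :=
    Finset.sum_le_sum_of_subset_of_nonneg (Finset.subset_univ _) fun _ _ _ => Nat.cast_nonneg _
  have h3 : (∑ j, ((holders S.μ j).card : ℝ)) + (idle S.μ).card ≤ P.n := by
    exact_mod_cast sum_card_holders_add_card_idle_le S.μ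
  linarith

/-- Every bid is either still held or released, and a good of price 0 has never lost a holder. -/
theorem Inv.count_none_le (H : Inv P v ω S C l τ τ₀) :
    C none ≤ ∑ j ∈ pricedGoods l, C (some j) := by
  have hb := H.bidders.balance
  have h1 : ∑ j, C (some j) ≤ ∑ j ∈ pricedGoods l, C (some j) + ∑ j, (holders S.μ j).card := by
    rw [← Finset.sum_filter_add_sum_filter_not Finset.univ fun j => l j ≠ 0]
    refine Nat.add_le_add le_rfl (le_trans (Finset.sum_le_sum fun j hj => ?_)
      (Finset.sum_le_sum_of_subset (Finset.subset_univ _)))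
    exact H.bidders.free_good j (by simpa using hj)
  omega

theorem Inv.mul_count_none_le (hP : P.Admissible) (H : Inv P v ω S C l τ τ₀) :
    P.α * C none ≤ (pricedGoods l).card * ((1 + P.α) * P.cap + P.α * (P.E + 1)) := by
  have h1 : (C none : ℝ) ≤ ∑ j ∈ pricedGoods l, (C (some j) : ℝ) := by
    exact_mod_cast H.count_none_le
  have h2 : ∑ j ∈ pricedGoods l, P.α * (C (some j) : ℝ) ≤
      (pricedGoods l).card • ((1 + P.α) * P.cap + P.α * (P.E + 1)) :=
    Finset.sum_le_card_nsmul _ _ _ fun j _ => H.bidders.count_le j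
  rw [← Finset.mul_sum, nsmul_eq_mul] at h2
  exact (mul_le_mul_of_nonneg_left h1 hP.α_pos.le).trans h2

/-! ### Near-optimal utilities and welfare at the final prices -/

/-- The price of a good, truncated to the range of the values. -/
def cappedPrice (P : Params) (l : Fin P.k → ℕ) (j : Fin P.k) : ℝ := min (P.α * l j) 1

/-- He bid at a reading below `(h + 1) * cap` and is satisfied, so the reading is still below `(h +
2) * cap`: at most one price step since. -/
theorem Inv.holder_price_le (hP : P.Admissible) (H : Inv P v ω S C l τ τ₀) {i : Fin P.n}
    {j : Fin P.k} (hs : Satisfied P S i) (hi : S.μ i = Slot.good j) :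
    P.α * l j ≤ v i j + P.α ∧ ∀ j', v i j' - P.α * l j' ≤ v i j - P.α * l j + P.α := by
  obtain ⟨h, h1, h2, h3⟩ := H.bidders.envyFree i j hi
  have hlt : (l j : ℝ) * P.cap < (h + 2) * P.cap := by
    linarith [H.counters.le_c j, hs j hi]
  have hle : l j ≤ h + 1 := by
    have : (l j : ℝ) < h + 2 := lt_of_mul_lt_mul_right hlt hP.cap_pos.le
    have : l j < h + 2 := by exact_mod_cast this
    omega
  have hle' : P.α * l j ≤ P.α * h + P.α := by
    have : (l j : ℝ) ≤ h + 1 := by exact_mod_cast hle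
    nlinarith [hP.α_pos]
  exact ⟨by linarith, fun j' => by linarith [h3 j']⟩

/-- Every bidder who holds something has nearly optimal utility at the final prices. -/
theorem Inv.utility_le (hP : P.Admissible) (hv : ∀ i j, 0 ≤ v i j ∧ v i j ≤ 1)
    (H : Inv P v ω S C l τ τ₀) (hs : ∀ i, Satisfied P S i) (i : Fin P.n)
    (o : Option (Fin P.k)) :
    o.elim 0 (v i) - o.elim 0 (cappedPrice P l) ≤
      (S.assignment i).elim 0 (v i) - (S.assignment i).elim 0 (cappedPrice P l) +
        if i ∈ idle S.μ then 1 else P.α := by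
  have hq0 : ∀ j, 0 ≤ cappedPrice P l j := fun j =>
    le_min (mul_nonneg hP.α_pos.le (Nat.cast_nonneg _)) zero_le_one
  have ho : ∀ x : ℝ, 0 ≤ x → (∀ j, v i j - P.α * l j ≤ x) →
      o.elim 0 (v i) - o.elim 0 (cappedPrice P l) ≤ x := by
    intro x hx h
    cases o with
    | none => simpa using hx
    | some j =>
      simp only [Option.elim_some, cappedPrice]
      rcases min_choice (P.α * l j) 1 with hm | hm <;> rw [hm]
      · exact h j
      -- Where the truncation binds, the utility is `v i j - 1 ≤ 0`, so truncating creates no better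
      -- option.
      · linarith [(hv i j).2]
  cases hi : S.μ i with
  | empty =>
    rw [if_pos (mem_idle.2 hi), State.assignment, hi]
    simp only [Option.elim_none]
    cases o with
    | none => simp
    | some j => simp only [Option.elim_some]; linarith [(hv i j).2, hq0 j]
  | bot =>
    rw [if_neg (by simp [hi]), State.assignment, hi]
    simp only [Option.elim_none]
    refine ho _ (by linarith [hP.α_pos]) fun j => ?_
    linarith [H.bidders.priced_out i hi j, hP.α_pos]
  | good j =>
    rw [if_neg (by simp [hi]), State.assignment_eq_some.2 hi]
    simp only [Option.elim_some]
    obtain ⟨h1, h2⟩ := H.holder_price_le hP (hs i) hi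
    have hle : cappedPrice P l j ≤ P.α * l j := min_le_left _ _
    exact ho _ (by linarith) fun j' => by linarith [h2 j']

theorem sum_elim_eq_sum_card_mul {n k : ℕ} (ν : Assignment n k) (q : Fin k → ℝ) :
    ∑ i, (ν i).elim 0 q = ∑ j, ((Finset.univ.filter fun i => ν i = some j).card : ℝ) * q j := by
  simp_rw [Finset.card_filter, Nat.cast_sum, Finset.sum_mul]
  rw [Finset.sum_comm]
  refine Finset.sum_congr rfl fun i _ => ?_
  cases ν i <;> simp

/-- The welfare of the assignment compared with that of any matching. -/
theorem Inv.welfare_le (hP : P.Admissible) (hv : ∀ i j, 0 ≤ v i j ∧ v i j ≤ 1)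
    (H : Inv P v ω S C l τ τ₀) (hs : ∀ i, Satisfied P S i) {ν : Assignment P.n P.k}
    (hν : IsMatching P.s ν) :
    welfare v ν ≤ welfare v S.assignment + (idle S.μ).card +
      P.α * (P.n - (idle S.μ).card) + (4 * P.E + 2) * (pricedGoods l).card := by
  have hsum := Finset.sum_le_sum fun i (_ : i ∈ Finset.univ) => H.utility_le hP hv hs i (ν i)
  rw [Finset.sum_add_distrib, Finset.sum_sub_distrib, Finset.sum_sub_distrib,
    sum_elim_eq_sum_card_mul ν, sum_elim_eq_sum_card_mul S.assignment] at hsum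
  have hslack : ∑ i, (if i ∈ idle S.μ then 1 else P.α) =
      (idle S.μ).card + P.α * (P.n - (idle S.μ).card) := by
    have : ∀ i, (if i ∈ idle S.μ then 1 else P.α) =
        P.α + if i ∈ idle S.μ then 1 - P.α else 0 := fun i => by split_ifs <;> ring
    rw [Finset.sum_congr rfl fun i _ => this i, Finset.sum_add_distrib, Finset.sum_ite_mem]
    simp
    ring
  have hprice : ∑ j, ((Finset.univ.filter fun i => ν i = some j).card : ℝ) * cappedPrice P l j -
      ∑ j, ((Finset.univ.filter fun i => S.assignment i = some j).card : ℝ) * cappedPrice P l j ≤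
      (4 * P.E + 2) * (pricedGoods l).card := by
    have hterm : ∀ j, ((Finset.univ.filter fun i => ν i = some j).card : ℝ) * cappedPrice P l j -
        ((Finset.univ.filter fun i => S.assignment i = some j).card : ℝ) * cappedPrice P l j ≤
        if l j ≠ 0 then 4 * P.E + 2 else 0 := by
      intro j
      rw [filter_assignment_eq_holders, ← sub_mul]
      split_ifs with hl
      -- At most `s` units are used by `ν` and at least `s - 4E - 2` are held here; truncation makes
      -- each missing unit cost at most 1.
      · have h1 : ((Finset.univ.filter fun i => ν i = some j).card : ℝ) ≤ P.s := by
          exact_mod_cast hν j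
        have h2 := H.le_card_holders hP hl
        rw [Params.cap_eq] at h2
        have h3 : cappedPrice P l j ≤ 1 := min_le_right _ _
        have h4 : 0 ≤ cappedPrice P l j :=
          le_min (mul_nonneg hP.α_pos.le (Nat.cast_nonneg _)) zero_le_one
        have hE := hP.E_nonneg
        calc _ ≤ (4 * P.E + 2) * cappedPrice P l j :=
              mul_le_mul_of_nonneg_right (by linarith) h4
          _ ≤ (4 * P.E + 2) * 1 := mul_le_mul_of_nonneg_left h3 (by linarith)
          _ = _ := mul_one _
      · have : l j = 0 := not_not.1 hl
        simp [cappedPrice, this]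
    rw [← Finset.sum_sub_distrib]
    refine (Finset.sum_le_sum fun j _ => hterm j).trans_eq ?_
    rw [← Finset.sum_filter, Finset.sum_const, nsmul_eq_mul, mul_comm]
    rfl
  unfold welfare
  linarith

end Final

/-! ### The parameters of the theorem -/

/-- The conditions on the parameters that guarantee the accuracy of the algorithm. -/
structure Params.Suitable (P : Params) : Prop where
  α_pos : 0 < P.α
  α_le : P.α ≤ 1 / 3
  ρ_eq : P.ρ = P.α
  one_le_E : 1 ≤ P.E
  supply : 16 * P.E + 4 ≤ 3 * P.α * P.s
  s_lt : (P.s : ℝ) < P.n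

namespace Params.Suitable

variable {P : Params}

theorem le_s (h : P.Suitable) : 16 * P.E + 4 ≤ P.s := by
  have h1 := h.supply
  have h2 : P.α * P.s ≤ 1 / 3 * P.s := mul_le_mul_of_nonneg_right h.α_le (Nat.cast_nonneg _)
  linarith

theorem admissible (h : P.Suitable) : P.Admissible where
  α_pos := h.α_pos
  E_nonneg := zero_le_one.trans h.one_le_E
  m_lt_cap := by
    rw [Params.cap_eq, Params.m]
    linarith [h.le_s, h.one_le_E]

theorem loss_le (h : P.Suitable) {K U : ℝ} (hK0 : 0 ≤ K) (hU : U ≤ P.ρ * P.n)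
    (hK : K * (P.cap - 2 * P.E - 1) ≤ P.n - U) :
    U + P.α * (P.n - U) + (4 * P.E + 2) * K ≤ 3 * P.α * P.n := by
  have ha := h.α_pos
  have ha3 := h.α_le
  -- `0.3 * (16E + 4) ≥ 4E + 2` exactly when `E ≥ 1`.
  have hD : 4 * P.E + 2 ≤ 9 / 10 * P.α * P.s := by linarith [h.supply, h.one_le_E]
  rw [h.ρ_eq] at hU
  rw [Params.cap_eq] at hK
  have hn : (0 : ℝ) ≤ P.n := Nat.cast_nonneg _
  set a := P.α
  set n := (P.n : ℝ)
  obtain ⟨w, hw⟩ : ∃ w, w = a * n - U := ⟨_, rfl⟩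
  have hw0 : 0 ≤ w := by linarith
  have hDK : (4 * P.E + 2) * K ≤ 9 / 10 * a * (P.s * K) := by
    have := mul_le_mul_of_nonneg_right hD hK0
    linarith
  have hQ : (1 - 9 / 10 * a) * (P.s * K) ≤ (1 - a) * n + w := by linarith
  -- The slack `w` in the bound on `U` allows more priced goods. Its coefficient is at most `0.3 /
  -- 0.7 = 3 / 7` since `a ≤ 1 / 3`, which the gain of `w` in `U` outweighs.
  have hkey : 9 / 10 * a * (P.s * K) ≤ 9 / 10 * a * n + 3 / 7 * w := by
    have hpos : 0 < 1 - 9 / 10 * a := by linarith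
    refine le_of_mul_le_mul_left ?_ hpos
    have e1 := mul_le_mul_of_nonneg_left hQ (by positivity : 0 ≤ 9 / 10 * a)
    have e2 : 9 / 10 * a * w ≤ (1 - 9 / 10 * a) * (3 / 7 * w) := by nlinarith
    have e3 : 0 ≤ a * (a * n) := by positivity
    nlinarith
  have hU' : U = a * n - w := by linarith
  rw [hU']
  have e4 : a * w ≤ 1 / 3 * w := mul_le_mul_of_nonneg_right ha3 hw0
  have e5 : 0 ≤ a * (a * n) := by positivity
  nlinarith

/-- The algorithm cannot use up all its rounds without halting. -/
theorem rounds_bound (h : P.Suitable) {K c₀ : ℝ} (hK0 : 0 ≤ K)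
    (hK : K * (P.cap - 2 * P.E - 1) ≤ P.n)
    (hc : P.α * c₀ ≤ K * ((1 + P.α) * P.cap + P.α * (P.E + 1))) :
    c₀ + P.E < (⌊P.T⌋₊ : ℝ) * (P.ρ * P.n - 2 * P.E) := by
  have ha := h.α_pos
  have ha3 := h.α_le
  have hE := h.one_le_E
  have hs := h.le_s
  have hEn : 16 * P.E + 4 ≤ 3 * P.α * P.n := by
    have := mul_le_mul_of_nonneg_left h.s_lt.le ha.le
    linarith [h.supply]
  have hT : P.T - 1 < ⌊P.T⌋₊ := Nat.sub_one_lt_floor _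
  have hTa : P.α ^ 2 * P.T = 8 := by
    rw [Params.T, h.ρ_eq]; field_simp
  have hn : (0 : ℝ) < P.n := lt_of_le_of_lt (Nat.cast_nonneg _) h.s_lt
  rw [h.ρ_eq]
  have hcap : P.cap ≤ 5 / 4 * (P.cap - 2 * P.E - 1) := by
    rw [Params.cap_eq]; linarith
  have hrhs : (1 + P.α) * P.cap + P.α * (P.E + 1) ≤ 5 / 3 * P.cap := by
    have hEc : P.E + 1 ≤ P.cap := by rw [Params.cap_eq]; linarith
    nlinarith
  -- `25 / 12 = (5 / 3) * (5 / 4)`, from the two preceding bounds.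
  have hup : P.α * c₀ ≤ 25 / 12 * P.n := by
    have h1 := mul_le_mul_of_nonneg_left hrhs hK0
    have h2 := mul_le_mul_of_nonneg_left hcap hK0
    linarith
  have hasq : P.α ^ 2 ≤ 1 / 9 := by nlinarith
  -- Rounding `T` down costs less than `α ^ 2 ≤ 1 / 9` out of `α ^ 2 * T = 8`.
  have hF : 71 / 9 ≤ P.α ^ 2 * ⌊P.T⌋₊ := by
    have := mul_le_mul_of_nonneg_left hT.le (sq_nonneg P.α)
    linarith
  -- The supply condition and `s < n` give `2E ≤ (3 / 8) * αn`.
  have hg : 5 / 8 * (P.α * P.n) ≤ P.α * P.n - 2 * P.E := by linarith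
  have hlow : 71 / 9 * (5 / 8) * P.n ≤ P.α * (⌊P.T⌋₊ * (P.α * P.n - 2 * P.E)) := by
    have h1 : P.α * (⌊P.T⌋₊ * (5 / 8 * (P.α * P.n))) ≤
        P.α * (⌊P.T⌋₊ * (P.α * P.n - 2 * P.E)) := by gcongr
    have h2 := mul_le_mul_of_nonneg_right hF (by positivity : 0 ≤ 5 / 8 * (P.n : ℝ))
    linarith
  have hEs : P.α * P.E ≤ P.n := by
    have h1 : P.E ≤ 3 / 16 * (P.α * P.n) := by linarith
    have h2 := mul_le_mul_of_nonneg_left h1 ha.le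
    have h3 : P.α ^ 2 * P.n ≤ 1 / 9 * P.n := mul_le_mul_of_nonneg_right hasq hn.le
    linarith
  refine lt_of_mul_lt_mul_left ?_ ha.le
  linarith

end Params.Suitable

/-- On good noise the algorithm computes a nearly optimal matching. -/
theorem pmatch_of_goodNoise {P : Params} (hP : P.Suitable) {v : Fin P.n → Fin P.k → ℝ}
    {tie : ℕ → Fin P.n → (Fin P.k → ℝ) → Fin P.k} (hv : ∀ i j, 0 ≤ v i j ∧ v i j ≤ 1)
    (htie : IsTieRule tie) {ω : Noise P.k} (hω : GoodNoise P.k P.E (P.n * ⌊P.T⌋₊) ω) :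
    IsMatching P.s (pmatch P v tie ω) ∧
      OPT P.s v - 3 * P.α * P.n ≤ welfare v (pmatch P v tie ω) := by
  have hA := hP.admissible
  obtain ⟨C, l, τ, H, hend⟩ := Inv.run hA hω (fun i j => (hv i j).2) htie ⌊P.T⌋₊ (r := 0)
    (Inv.init (v := v) (ω := ω) hA) (by simp) (by simp [State.init, CounterState.init])
  have hidle : (0 : ℝ) ≤ (idle (run P v tie ω ⌊P.T⌋₊ 0 (State.init P.n P.k)).μ).card :=
    Nat.cast_nonneg _
  have hK := H.card_pricedGoods_mul_le hA
  rcases hend with ⟨hs, hU⟩ | hlarge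
  · refine ⟨H.isMatching hs, ?_⟩
    have hloss := hP.loss_le (Nat.cast_nonneg _) hU.le hK
    rw [sub_le_iff_le_add]
    refine csSup_le ?_ ?_
    · exact ⟨_, _, H.isMatching hs, rfl⟩
    · rintro _ ⟨ν, hν, rfl⟩
      have := H.welfare_le hA hv hs hν
      rw [pmatch]
      linarith
  · exfalso
    have h1 := hP.rounds_bound (Nat.cast_nonneg _) (hK.trans (by linarith)) (H.mul_count_none_le hA)
    have h2 := (H.counters.accurate none).out_le
    rw [zero_add] at hlarge
    linarith

end

end PrivMatch

/-! ### Assembly of the theorem -/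

theorem mainTheorem1 :
    (∃ (C : ℝ) (e : ℕ), ∀ (n k : ℕ) (α ε γ : ℝ), 1 ≤ n → 1 ≤ k → 0 < α → α ≤ 1 → 0 < ε →
      0 < γ → γ ≤ 1 → 1 ≤ PrivMatch.Eprime n k α ε γ →
      (16 * PrivMatch.Eprime n k α ε γ + 4) / α ≤
        C * (1 / (α ^ 3 * ε)) *
          (1 + Real.log n + Real.log k + Real.log (1 / α) + Real.log (1 / γ)) ^ e) ∧
    (∀ (n k s : ℕ) (α ε γ : ℝ) (v : Fin n → Fin k → ℝ)
      (tie : ℕ → Fin n → (Fin k → ℝ) → Fin k),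
      1 ≤ k → 0 < α → α ≤ 1 → 0 < ε → 0 < γ → γ ≤ 1 →
      (∀ i j, 0 ≤ v i j ∧ v i j ≤ 1) → PrivMatch.IsTieRule tie →
      1 ≤ PrivMatch.Eprime n k α ε γ →
      (16 * PrivMatch.Eprime n k α ε γ + 4) / α ≤ (s : ℝ) → s < n →
      ENNReal.ofReal (1 - γ) ≤
        PrivMatch.noiseLaw ⟨n, k, s, α / 3, α / 3, ε, γ⟩
          {ω | PrivMatch.IsMatching s (PrivMatch.pmatch ⟨n, k, s, α / 3, α / 3, ε, γ⟩ v tie ω) ∧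
            PrivMatch.OPT s v - α * n ≤
              PrivMatch.welfare v (PrivMatch.pmatch ⟨n, k, s, α / 3, α / 3, ε, γ⟩ v tie ω)}) := by
  refine ⟨⟨_, 4, fun n k α ε γ hn hk hα hα1 hε hγ hγ1 hE =>
    PrivMatch.supply_le_polylog hn hk hα hα1 hε hγ hγ1 hE⟩, ?_⟩
  intro n k s α ε γ v tie hk hα hα1 hε hγ hγ1 hv htie hE hs hsn
  set P : PrivMatch.Params := ⟨n, k, s, α / 3, α / 3, ε, γ⟩ with hPdef
  have hT : P.T = 72 / α ^ 2 := PrivMatch.Params.T_third n k s α ε γ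
  have hPE : P.E = PrivMatch.Eprime n k α ε γ := PrivMatch.Params.E_third n k s hα
  have hT72 : 72 ≤ P.T := by
    rw [hT, le_div_iff₀ (by positivity)]
    have : α ^ 2 ≤ 1 := pow_le_one₀ hα.le hα1
    linarith
  have hn1 : (1 : ℝ) ≤ n := by exact_mod_cast (show 1 ≤ n by omega)
  have hP : P.Suitable :=
    { α_pos := by simp only [hPdef]; positivity
      α_le := by simp only [hPdef]; linarith
      ρ_eq := rfl
      one_le_E := by rwa [hPE]
      supply := by
        rw [hPE]
        rw [div_le_iff₀ hα] at hs
        simp only [hPdef]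
        linarith
      s_lt := by simp only [hPdef]; exact_mod_cast hsn }
  have hε' : 0 < P.ε' := div_pos hε (by linarith)
  have hM : 32 ≤ (n : ℝ) * P.T := by nlinarith
  -- Each counter reads `n` items per round, so accuracy is needed only up to time `n * ⌊T⌋`.
  have hN : ((n * ⌊P.T⌋₊ : ℕ) : ℝ) ≤ n * P.T := by
    push_cast
    exact mul_le_mul_of_nonneg_left (Nat.floor_le (by linarith)) (by linarith)
  have hb : 0 < PrivMatch.counterScale P.ε' (n * P.T) :=
    div_pos (Real.logb_pos (by norm_num) (by linarith)) hε'
  refine PrivMatch.le_measure_of_goodNoise (E := P.E) (N := n * ⌊P.T⌋₊) hb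
    (PrivMatch.failure_bound hk hγ hγ1 hε' hM hN) fun ω hω => ?_
  have h := PrivMatch.pmatch_of_goodNoise hP (v := v) hv htie hω
  refine ⟨h.1, ?_⟩
  have h3 : 3 * P.α * P.n = α * n := by simp only [hPdef]; ring
  have h2 := h.2
  rw [h3] at h2
  exact h2
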